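/- **Setting.** Let $G=(V,E)$ be a finite directed acyclic graph with $n$ vertices, $m$ edges and a positive integer weight $w(e)$ on each edge; $G$ need not be connected. Let $L$ be the number of edges of a longest path, $\delta(x,y)$ the shortest path distance ($\infty$ if there is no path), $\sigma_{xy}$ the number of shortest $x$–$y$ paths, $\sigma_{xy}(v)$ the number of those through $v$, $P_x(y)$ the set of predecessors of $y$ on shortest paths from $x$, $\delta_{x\bullet}(y)=\sum_{t\ne x,y}\sigma_{xt}(y)/\sigma_{xt}$, and $BC(v)=\sum_{s\ne v,\,t\ne v}\sigma_{st}(v)/\sigma_{st}$ (pairs with $\sigma_{st}=0$ contribute $0$). **Model.** In the synchronous CONGEST model on the undirected version of $G$, every vertex has a unique ID. Initially it knows its ID, the IDs of its in- and out-neighbors, the weights of its incident edges and, if "$n$ is known", the number $n$. In each round a vertex sends at most one message of $O(B)$ bits to each neighbor, receives the messages sent to it in this round, and computes locally without restriction. The rounds are counted until every vertex has terminated with its output. Here $B$ is $\log n$ plus the length of the largest values that naturally occur: the finite $\delta(x,y)$ and the $\sigma_{xy}$, and for BC also the values $(1+\delta_{x\bullet}(y))/\sigma_{xy}$ written as fractions.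 An algorithm computes APSP if each vertex $y$ outputs $\delta(x,y)$, $\sigma_{xy}$ and $P_x(y)$ for all $x\in V$, and BC if each vertex $v$ outputs $BC(v)$. **The APSP algorithm ($n$ known, IDs $1,\dots,n$).** *Longest length tree:* as soon as $v$ has received the levels of all its in-neighbors, it sets its level $\ell(v)$ to the maximum of $\ell(u)+1$ over these ($\ell(v)=0$ if $v$ has no in-neighbor) and sends $\ell(v)$ to all out-neighbors. *Shortest paths:* at absolute time $\tau_{xy}=ID_x+\ell(y)$ (time $0$ being the first round), $y$ computes $\delta(x,y)=\min_u(\delta(x,u)+w(u,y))$, $P_x(y)$ and $\sigma_{xy}=\sum_{u\in P_x(y)}\sigma_{xu}$ from the received messages ($\delta(x,x)=0$, $\sigma_{xx}=1$) and, if $\delta(x,y)<\infty$, sends $(x,\delta(x,y),\sigma_{xy})$ to all out-neighbors. **The BC algorithm ($n$ known, IDs $1,\dots,n$).** The vertices run the APSP algorithm; moreover each $y$ learns the largest level $M(y)$ of a vertex reachable from $y$, as each vertex sends this number to its in-neighbors once it has it from all out-neighbors. Let $R_y=n+M(y)$. With its clock reset to $0$ at time $R_y$, vertex $y$ sends $(1+\delta_{x\bullet}(y))/\sigma_{xy}$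 to the vertices of $P_x(y)$ in round $R_y-\tau_{xy}$, and a vertex $u$ that receives such a value $q$ for the source $x$ adds $\sigma_{xu}\,q$ to its current value of $\delta_{x\bullet}(u)$ (initially $0$). Finally $v$ outputs $\sum_{x\ne v}\delta_{x\bullet}(v)$. **$n$ unknown, unique IDs in $\{1,\dots,n^k\}$ for some $k$.** In a first phase, every vertex keeps a lexicographically ordered list of pairs (undirected hop distance, ID), in round $r$ sends to all neighbors the pair whose distance plus position on the list is $r$, and keeps the smallest distance received for each ID. With $j$ pairs on its list after $2j$ rounds, all of distance less than $j$, the vertex knows all IDs of its connected component, replaces them by their ranks $1,\dots,j$, and starts the above APSP or BC algorithm on its component at absolute time $0$ with $j$ in place of $n$. **Theorem.** 1. If $n$ is known, the APSP algorithm computes APSP in $n+O(L)$ rounds, sending at most $mn+m$ messages. 2. If $n$ is known, the BC algorithm computes BC in $2n+O(L)$ rounds, sending at most $2mn+m$ messages. 3. If $n$ is not known, the APSP algorithm preceded by the first phase computes APSP in $O(n)$ rounds, sending $O(mn)$ messages. 4. If $n$ is not known, the BC algorithm preceded by the first phase computes BC in $O(n)$ rounds, sending $O(mn)$ messages. The constants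 for rounds and messages are absolute. The constant in the message length $O(B)$ is absolute in 1 and 2, and an absolute constant times $k+1$ in 3 and 4. -/

import Mathlib

/-! # Weighted dags, shortest paths, betweenness centrality -/

/-- A finite weighted directed acyclic graph. A vertex is identified with its unique ID, a natural
number. Edge weights are positive integers. -/
structure WDag where
  verts : Finset ℕ
  edges : Finset (ℕ × ℕ)
  weight : ℕ → ℕ → ℕ
  edges_mem : ∀ e ∈ edges, e.1 ∈ verts ∧ e.2 ∈ verts
  weight_pos : ∀ e ∈ edges, 0 < weight e.1 e.2
  acyclic : ∀ v, ¬ Relation.TransGen (fun a b => (a, b) ∈ edges) v v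

namespace WDag

/-- The number of vertices. -/
def n (G : WDag) : ℕ := G.verts.card

/-- The number of edges. -/
def m (G : WDag) : ℕ := G.edges.card

/-- `p` lists the vertices of a directed path from `x` to `y` (the one-vertex path included). -/
def IsPath (G : WDag) (x y : ℕ) (p : List ℕ) : Prop :=
  (∀ v ∈ p, v ∈ G.verts) ∧ p.IsChain (fun a b => (a, b) ∈ G.edges) ∧
    p.head? = some x ∧ p.getLast? = some y

/-- The sum of the edge weights along a list of vertices. -/
def pathWeight (G : WDag) : List ℕ → ℕ
  | [] => 0
  | [_] => 0
  | a :: b :: l => G.weight a b + G.pathWeight (b :: l)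

/-- The number of edges of a longest path. -/
noncomputable def longest (G : WDag) : ℕ :=
  sSup {k | ∃ x y p, G.IsPath x y p ∧ p.length = k + 1}

/-- The shortest path distance from `x` to `y`, which is `⊤` if there is no path. -/
noncomputable def dist (G : WDag) (x y : ℕ) : ℕ∞ :=
  ⨅ p ∈ {p | G.IsPath x y p}, (G.pathWeight p : ℕ∞)

/-- The shortest paths from `x` to `y`. -/
def shortestPaths (G : WDag) (x y : ℕ) : Set (List ℕ) :=
  {p | G.IsPath x y p ∧ ∀ q, G.IsPath x y q → G.pathWeight p ≤ G.pathWeight q}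

/-- The number of shortest paths from `x` to `y`. -/
noncomputable def numSP (G : WDag) (x y : ℕ) : ℕ := (G.shortestPaths x y).ncard

/-- The number of shortest paths from `x` to `y` that pass through `v`. -/
noncomputable def numSPThrough (G : WDag) (x y v : ℕ) : ℕ :=
  {p ∈ G.shortestPaths x y | v ∈ p}.ncard

open Classical in
/-- The predecessors of `y` in the shortest path dag of the source `x`. -/
noncomputable def preds (G : WDag) (x y : ℕ) : Finset ℕ :=
  {u ∈ G.verts | (u, y) ∈ G.edges ∧ G.dist x y ≠ ⊤ ∧
    G.dist x u + (G.weight u y : ℕ∞) = G.dist x y}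

/-- The dependency of the source `s` on `v`. Pairs without a path contribute `0 / 0 = 0`. -/
noncomputable def dependency (G : WDag) (s v : ℕ) : ℚ :=
  ∑ t ∈ G.verts \ {v, s}, (G.numSPThrough s t v : ℚ) / G.numSP s t

/-- The betweenness centrality of `v`. Pairs without a path contribute `0 / 0 = 0`. -/
noncomputable def bc (G : WDag) (v : ℕ) : ℚ :=
  ∑ s ∈ G.verts.erase v, ∑ t ∈ G.verts.erase v, (G.numSPThrough s t v : ℚ) / G.numSP s t

end WDag

/-! # The CONGEST model -/

/-- What a node knows of the graph at the start: its own ID, the IDs of its incoming and outgoing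
neighbors, and the weights of its incident edges. -/
structure LocalView where
  self : ℕ
  ins : Finset ℕ
  outs : Finset ℕ
  wIn : ℕ → ℕ
  wOut : ℕ → ℕ

/-- The initial knowledge of the node `v`. -/
def WDag.view (G : WDag) (v : ℕ) : LocalView where
  self := v
  ins := {u ∈ G.verts | (u, v) ∈ G.edges}
  outs := {u ∈ G.verts | (v, u) ∈ G.edges}
  wIn := fun u => if (u, v) ∈ G.edges then G.weight u v else 0
  wOut := fun u => if (v, u) ∈ G.edges then G.weight v u else 0

/-- The communication network is the undirected version of `G`. -/
abbrev WDag.Linked (G : WDag) (u v : ℕ) : Prop := (u, v) ∈ G.edges ∨ (v, u) ∈ G.edges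

/-- A deterministic synchronous message passing algorithm. In each round, a node that has not
terminated sends at most one message to each neighbor (`send s v` is the message for the neighbor
`v`), receives the messages sent to it in this round (`inbox u` is the one from the neighbor `u`),
and updates its state. A node has terminated once `output` is not `none`. -/
structure DistAlg (Input Msg Out : Type) where
  State : Type
  init : Input → State
  send : State → ℕ → Option Msg
  recv : State → (ℕ → Option Msg) → State
  output : State → Option Out

namespace DistAlg

variable {Input Msg Out : Type}

/-- The message sent from `u` to `v`, given the current states of the nodes. -/
def sentBy (A : DistAlg Input Msg Out) (G : WDag) (st : ℕ → A.State) (u v : ℕ) : Option Msg :=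
  if G.Linked u v ∧ (A.output (st u)).isNone then A.send (st u) v else none

/-- The effect of one round on the states of the nodes. -/
def round (A : DistAlg Input Msg Out) (G : WDag) (st : ℕ → A.State) (v : ℕ) : A.State :=
  if (A.output (st v)).isNone then A.recv (st v) (fun u => A.sentBy G st u v) else st v

/-- The states of the nodes after `t` rounds, if the node `v` has the initial input `inp v`. -/
def states (A : DistAlg Input Msg Out) (G : WDag) (inp : ℕ → Input) : ℕ → ℕ → A.State
  | 0 => fun v => A.init (inp v)
  | t + 1 => A.round G (A.states G inp t)

/-- The message sent from `u` to `v` in the round that follows the first `t` rounds. -/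
def sent (A : DistAlg Input Msg Out) (G : WDag) (inp : ℕ → Input) (t u v : ℕ) : Option Msg :=
  A.sentBy G (A.states G inp t) u v

/-- The number of messages sent in the first `T` rounds. -/
def messages (A : DistAlg Input Msg Out) (G : WDag) (inp : ℕ → Input) (T : ℕ) : ℕ :=
  ∑ t ∈ Finset.range T,
    {e ∈ G.verts ×ˢ G.verts | (A.sent G inp t e.1 e.2).isSome}.card

/-- On `G`, all nodes have terminated after at most `rounds` rounds, the output of each node meets
the specification `spec`, at most `msgs` messages have been sent, and no message is longer than
`len` bits, where `bits` is the length of a message. (Terminated nodes send nothing.) -/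
def Computes (A : DistAlg Input Msg Out) (bits : Msg → ℕ) (G : WDag) (inp : ℕ → Input)
    (spec : ℕ → Out → Prop) (rounds msgs len : ℕ) : Prop :=
  ∃ T ≤ rounds,
    (∀ v ∈ G.verts, ∃ o, A.output (A.states G inp T v) = some o ∧ spec v o) ∧
    A.messages G inp T ≤ msgs ∧
    ∀ t, ∀ u ∈ G.verts, ∀ v ∈ G.verts, ∀ μ, A.sent G inp t u v = some μ → bits μ ≤ len

end DistAlg

/-! # The algorithms -/

/-- The messages: `ident d s` says that the node `s` is at undirected distance (at most) `d` from
the sender; `level l` is the level of the sender in the longest length tree; `sssp x d c` gives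
distance and number of shortest paths from `x` to the sender; `top M` is the largest level
of a node reachable from the sender; `acc x q` is an accumulation value for the source `x`. -/
inductive Msg where
  | ident (d s : ℕ)
  | level (l : ℕ)
  | sssp (x d c : ℕ)
  | top (M : ℕ)
  | acc (x : ℕ) (q : ℚ)

/-- Length in bits of a rational number, written as a fraction. -/
def ratBits (q : ℚ) : ℕ := q.num.natAbs.size + q.den.size

/-- Length in bits of a message: three bits for its kind, and its numbers in binary. -/
def Msg.bits : Msg → ℕ
  | .ident d s => 3 + d.size + s.size
  | .level l => 3 + l.size
  | .sssp x d c => 3 + x.size + d.size + c.size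
  | .top M => 3 + M.size
  | .acc x q => 3 + x.size + ratBits q

/-- The smallest element of a finite set, if there is one. -/
def pick {α : Type} [LinearOrder α] (F : Finset α) : Option α := (F.sort (· ≤ ·)).head?

/-! ## APSP -/

/-- The state of a node in the APSP algorithm: `ids` is the set of the IDs of all nodes,
`nbrLevel u` the level received from the incoming neighbor `u`, and `got u x` the pair
(distance, number of shortest paths) for the source `x` received from `u`. -/
structure Core where
  view : LocalView
  ids : Finset ℕ
  clock : ℕ
  nbrLevel : ℕ → Option ℕ
  levelSent : Bool
  got : ℕ → ℕ → Option (ℕ × ℕ)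

namespace Core

/-- The state at absolute time 0. -/
def start (view : LocalView) (ids : Finset ℕ) : Core where
  view := view
  ids := ids
  clock := 0
  nbrLevel := fun _ => none
  levelSent := false
  got := fun _ _ => none

/-- The new ID, between 1 and n, of the node `x`. If the IDs are 1, …, n, it is `x` itself. -/
def newId (s : Core) (x : ℕ) : ℕ := {z ∈ s.ids | z ≤ x}.card

/-- The level of the node in the longest length tree. It is known once all incoming neighbors have
sent their levels; a node without incoming edges has level 0. -/
def level? (s : Core) : Option ℕ :=
  if ∀ u ∈ s.view.ins, (s.nbrLevel u).isSome then
    some (s.view.ins.sup fun u => (s.nbrLevel u).getD 0 + 1)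
  else none

/-- The length of the best path from `x` that ends with the edge from `u`. -/
def via (s : Core) (x u : ℕ) : WithTop ℕ :=
  match s.got u x with
  | some p => ((p.1 + s.view.wIn u : ℕ) : WithTop ℕ)
  | none => ⊤

/-- The distance from `x` to the node. -/
def dist (s : Core) (x : ℕ) : WithTop ℕ :=
  if x = s.view.self then ((0 : ℕ) : WithTop ℕ) else s.view.ins.inf (s.via x)

/-- The predecessors of the node in the shortest path dag of `x`. -/
def preds (s : Core) (x : ℕ) : Finset ℕ :=
  if x = s.view.self ∨ s.dist x = ⊤ then ∅ else {u ∈ s.view.ins | s.via x u = s.dist x}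

/-- The number of shortest paths from `x` to the node. -/
def count (s : Core) (x : ℕ) : ℕ :=
  if x = s.view.self then 1
  else ∑ u ∈ s.preds x, ((s.got u x).map Prod.snd).getD 0

/-- As soon as its level is known, the node sends it along all outgoing edges. At
absolute time (new ID of `x`) + (its level), it sends distance and number of shortest paths for
the source `x` along all outgoing edges, if the distance is finite. -/
def send (s : Core) (v : ℕ) : Option Msg :=
  if v ∈ s.view.outs then
    match s.level? with
    | none => none
    | some l =>
      if s.levelSent = false then some (.level l)
      else
        match pick {x ∈ s.ids | s.newId x + l = s.clock} with
        | none => none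
        | some x =>
          match s.dist x with
          | none => none
          | some d => some (.sssp x d (s.count x))
  else none

/-- Storing the received messages. -/
def recv (s : Core) (inbox : ℕ → Option Msg) : Core where
  view := s.view
  ids := s.ids
  clock := s.clock + 1
  nbrLevel := fun u =>
    match inbox u with
    | some (.level l) => some l
    | _ => s.nbrLevel u
  levelSent := s.level?.isSome
  got := fun u x =>
    match inbox u with
    | some (.sssp x' d c) => if x' = x then some (d, c) else s.got u x
    | _ => s.got u x

/-- The output of the APSP algorithm at the node `y`, as functions of the source `x`:
the distance from `x` to `y`, the number of shortest paths from `x` to `y`, and the predecessors of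
`y` in the shortest path dag of `x`. -/
structure Output where
  dist : ℕ → ℕ∞
  count : ℕ → ℕ
  preds : ℕ → Finset ℕ

/-- The node terminates when the time of all sources is over. -/
def output (s : Core) : Option Output :=
  match s.level? with
  | none => none
  | some l =>
    if s.ids.card + l + (if s.view.outs = ∅ then 0 else 1) ≤ s.clock then
      some ⟨s.dist, s.count, s.preds⟩
    else none

end Core

/-- The weighted dag APSP algorithm for known `n` and IDs 1, …, n. A node starts with `n` and its
local view. -/
def dagAPSP : DistAlg (ℕ × LocalView) Msg Core.Output where
  State := Core
  init := fun i => Core.start i.2 (Finset.Icc 1 i.1)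
  send := Core.send
  recv := Core.recv
  output := Core.output

/-! ## Betweenness centrality -/

/-- The state of a node in the BC algorithm: `succTop w` is the value received from the outgoing
neighbor `w` in a `top` message, and `dep x` the current dependency of the source `x` on the
node. -/
structure BCState where
  core : Core
  succTop : ℕ → Option ℕ
  topSent : Bool
  dep : ℕ → ℚ

namespace BCState

/-- The state at absolute time 0. -/
def start (view : LocalView) (ids : Finset ℕ) : BCState where
  core := Core.start view ids
  succTop := fun _ => none
  topSent := false
  dep := fun _ => 0

/-- The largest level of a node reachable from the node (itself included). It is known once the
level of the node is known and all outgoing neighbors have sent their values. -/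
def top? (s : BCState) : Option ℕ :=
  match s.core.level? with
  | none => none
  | some l =>
    if ∀ w ∈ s.core.view.outs, (s.succTop w).isSome then
      some (max l (s.core.view.outs.sup fun w => (s.succTop w).getD 0))
    else none

/-- The termination round of the APSP computation among the nodes reachable from the node, given
the largest level `M` of these: their last distances are final at time n + `M`. -/
def termRound (s : BCState) (M : ℕ) : ℕ := s.core.ids.card + M

/-- Along outgoing edges, the node runs the APSP algorithm. Along incoming edges, it first sends
its `top` value. Then, with its clock set to 0 at its termination round `R`, it sends in the
accumulation round `R - τ` the value (1 + dependency) / (number of shortest paths) for the source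
`x` to its predecessors for `x`, where `τ` is the time of `x` in the APSP algorithm. -/
def send (s : BCState) (v : ℕ) : Option Msg :=
  if v ∈ s.core.view.outs then s.core.send v
  else if v ∈ s.core.view.ins then
    match s.core.level?, s.top? with
    | some l, some M =>
      if s.topSent = false then some (.top M)
      else
        match pick {x ∈ s.core.ids |
            s.core.clock + (s.core.newId x + l) = s.termRound M + s.termRound M} with
        | none => none
        | some x =>
          if v ∈ s.core.preds x then some (.acc x ((1 + s.dep x) / (s.core.count x : ℚ)))
          else none
    | _, _ => none
  else none

/-- The increase of the dependency of `x` due to a message, if `c` is the number of shortest paths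
from `x`. -/
def accGain (c : ℕ) (x : ℕ) : Option Msg → ℚ
  | some (.acc x' q) => if x' = x then (c : ℚ) * q else 0
  | _ => 0

/-- Processing the received messages. -/
def recv (s : BCState) (inbox : ℕ → Option Msg) : BCState where
  core := s.core.recv inbox
  succTop := fun w =>
    match inbox w with
    | some (.top M) => some M
    | _ => s.succTop w
  topSent := s.top?.isSome
  dep := fun x => s.dep x + ∑ w ∈ s.core.view.outs, accGain (s.core.count x) x (inbox w)

/-- The node terminates when the accumulation rounds of all sources are over, and outputs the sum of
its dependencies. -/
def output (s : BCState) : Option ℚ :=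
  match s.core.level?, s.top? with
  | some l, some M =>
    if s.termRound M + s.termRound M ≤ s.core.clock + l then
      some (∑ x ∈ s.core.ids.erase s.core.view.self, s.dep x)
    else none
  | _, _ => none

end BCState

/-- The weighted dag BC algorithm for known `n` and IDs 1, …, n: the APSP algorithm followed by the
accumulation in reversed time. -/
def dagBC : DistAlg (ℕ × LocalView) Msg ℚ where
  State := BCState
  init := fun i => BCState.start i.2 (Finset.Icc 1 i.1)
  send := BCState.send
  recv := BCState.recv
  output := BCState.output

/-! ## Computing `n` and new IDs -/

/-- The state of a node while the IDs are spread: `list` is the ordered list of the pairs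
(distance, ID) known to it, for the distances in the undirected network. -/
structure Census where
  view : LocalView
  clock : ℕ
  list : Finset (ℕ ×ₗ ℕ)

namespace Census

/-- Initially, a node knows itself only. -/
def start (view : LocalView) : Census where
  view := view
  clock := 0
  list := {toLex (0, view.self)}

/-- The position of a pair on the list, starting from 1. -/
def index (s : Census) (p : ℕ ×ₗ ℕ) : ℕ := {q ∈ s.list | q ≤ p}.card

/-- In round `r` (which is the round after the first `r - 1` ones), the pair with
distance + position = `r` is sent to all neighbors. -/
def send (s : Census) (v : ℕ) : Option Msg :=
  if v ∈ s.view.ins ∪ s.view.outs then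
    match pick {p ∈ s.list | (ofLex p).1 + s.index p = s.clock + 1} with
    | none => none
    | some p => some (.ident (ofLex p).1 (ofLex p).2)
  else none

/-- The pair added because of a message. -/
def offer : Option Msg → Finset (ℕ ×ₗ ℕ)
  | some (.ident d z) => {toLex (d + 1, z)}
  | _ => ∅

/-- The received pairs are added, and the pair of smallest distance is kept for each ID. -/
def recv (s : Census) (inbox : ℕ → Option Msg) : Census where
  view := s.view
  clock := s.clock + 1
  list :=
    let all := s.list ∪ (s.view.ins ∪ s.view.outs).biUnion fun u => offer (inbox u)
    {p ∈ all | ∀ q ∈ all, (ofLex q).2 = (ofLex p).2 → (ofLex p).1 ≤ (ofLex q).1}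

/-- The IDs known to the node. -/
def ids (s : Census) : Finset ℕ := s.list.image fun p => (ofLex p).2

/-- The node has the IDs of all nodes of its connected component, and all other nodes
of the component have them too: with `k` pairs on the list, `2 k` rounds have passed, and
all distances are smaller than `k`. -/
abbrev Complete (s : Census) : Prop :=
  s.clock = 2 * s.list.card ∧ ∀ p ∈ s.list, (ofLex p).1 < s.list.card

end Census

/-- The algorithm `A` for unknown `n`: the nodes first collect the IDs of all nodes in their connected
component of the network, and then run `A` on their component with absolute time set to 0. Here
`start view ids` is the initial state of `A` at a node that knows the set `ids` of all IDs. -/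
def withCensus {Input Out : Type} (A : DistAlg Input Msg Out)
    (start : LocalView → Finset ℕ → A.State) : DistAlg LocalView Msg Out where
  State := Census ⊕ A.State
  init := fun view => Sum.inl (Census.start view)
  send := fun s v =>
    match s with
    | .inl c => c.send v
    | .inr a => A.send a v
  recv := fun s inbox =>
    match s with
    | .inl c =>
      let c' := c.recv inbox
      if c'.Complete then .inr (start c'.view c'.ids) else .inl c'
    | .inr a => .inr (A.recv a inbox)
  output := fun s =>
    match s with
    | .inl _ => none
    | .inr a => A.output a

/-- The weighted dag APSP algorithm for unknown `n`. A node starts with its local view only. -/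
def dagAPSPUnknown : DistAlg LocalView Msg Core.Output := withCensus dagAPSP Core.start

/-- The weighted dag BC algorithm for unknown `n`. A node starts with its local view only. -/
def dagBCUnknown : DistAlg LocalView Msg ℚ := withCensus dagBC BCState.start

/-! # Specifications -/

/-- The output of the node `y` is correct for APSP: it has, for every source `x`, the distance from
`x`, the number of shortest paths from `x`, and the predecessors for `x`. -/
def WDag.APSPSpec (G : WDag) (y : ℕ) (o : Core.Output) : Prop :=
  ∀ x ∈ G.verts, o.dist x = G.dist x y ∧ o.count x = G.numSP x y ∧ o.preds x = G.preds x y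

/-- The output of the node `v` is correct for BC. -/
def WDag.BCSpec (G : WDag) (v : ℕ) (o : ℚ) : Prop := o = G.bc v

/-- The parameter B of the model for APSP: log n plus the length in bits of the largest values, which
are the finite distances and the numbers of shortest paths. -/
noncomputable def WDag.apspB (G : WDag) : ℕ :=
  G.n.size +
    (G.verts ×ˢ G.verts).sup fun e => (G.dist e.1 e.2).toNat.size + (G.numSP e.1 e.2).size

/-- The parameter B of the model for BC, where the accumulation values
(1 + dependency) / (number of shortest paths) occur too. -/
noncomputable def WDag.bcB (G : WDag) : ℕ :=
  G.apspB +
    (G.verts ×ˢ G.verts).sup fun e =>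
      ratBits ((1 + G.dependency e.1 e.2) / (G.numSP e.1 e.2 : ℚ))

/-! # Paths in a weighted dag -/

namespace WDag

variable (G : WDag)

/-! Each run is described by a closed formula for the state of every node at every time, as if no
node ever stopped (`coreAt`, `bcAt`, `delayed`). One round carries the formula at time `t` to the
formula at time `t + 1`; outputs, message counts and message lengths are then read off. Termination
is put back by `Quiet`: a node whose output is ready would stay silent in the endless run anyway, so
its neighbors cannot tell whether it stopped (`states_cases`).

APSP works because the time rank of `x` + level of `y` strictly increases along edges: all data for
the source `x` arrive before `y` needs them. For a fixed node these times differ for different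
sources and exceed its level, so no two messages compete for one round (`coreAt_via`,
`coreAt_send_sssp`, `coreAt_succ`). What is computed is the recursion over the last edge of a
shortest path (`dist_eq_inf`, `ncard_shortestPaths`).

For BC, the dependencies satisfy a recursion over successors in the shortest path dag
(`dependency_eq_sum`). Write `R` for n plus the largest level reachable from the node. The sending
time is 2`R` minus the APSP time. Along an edge `R` does not grow while the APSP time grows, so the
head always sends before the tail (`bcAt_dep`), although `R` differs from node to node. The largest
reachable level is known early enough by `topTime_add_lev_le`.

For unknown n, a pair whose true distance plus final position is at most `t + 1` is on the list
after `t` rounds (`key_mem_list`). Distance is smaller than position, hence the lists are final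
after twice the component size many rounds. An incomplete list is never mistaken for a complete one
(`not_census_complete`), so a whole component switches in the same round. -/

@[simp] theorem mem_ins {u v : ℕ} : u ∈ (G.view v).ins ↔ (u, v) ∈ G.edges := by
  simp only [view, Finset.mem_filter, and_iff_right_iff_imp]
  exact fun h => (G.edges_mem _ h).1

@[simp] theorem mem_outs {u v : ℕ} : u ∈ (G.view v).outs ↔ (v, u) ∈ G.edges := by
  simp only [view, Finset.mem_filter, and_iff_right_iff_imp]
  exact fun h => (G.edges_mem _ h).2

theorem view_wIn {u v : ℕ} (h : (u, v) ∈ G.edges) : (G.view v).wIn u = G.weight u v := by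
  simp [view, h]

/-- Edges stay inside a finite vertex set, on which reachability by nonempty paths is a strict
order. All recursions and inductions along edges rest on this. -/
theorem wellFounded_edges : WellFounded fun a b => (a, b) ∈ G.edges := by
  let r : ℕ → ℕ → Prop := Relation.TransGen fun a b => (a, b) ∈ G.edges
  have : IsStrictOrder ℕ r :=
    { irrefl := G.acyclic, trans := fun _ _ _ => Relation.TransGen.trans }
  have h := Set.wellFoundedOn_iff.1 (G.verts.wellFoundedOn (r := r))
  refine Subrelation.wf (fun {a b} hab => ?_) h
  exact ⟨Relation.TransGen.single hab, (G.edges_mem _ hab).1, (G.edges_mem _ hab).2⟩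

theorem not_edge_self (v : ℕ) : (v, v) ∉ G.edges :=
  fun h => G.acyclic v (Relation.TransGen.single h)

theorem not_edge_symm {u v : ℕ} (h : (u, v) ∈ G.edges) : (v, u) ∉ G.edges :=
  fun h' => G.acyclic v ((Relation.TransGen.single h').tail h)

/-- The level of a node in the longest length tree. -/
noncomputable def lev : ℕ → ℕ :=
  G.wellFounded_edges.fix fun v ih =>
    (G.view v).ins.attach.sup fun u => ih u.1 (G.mem_ins.1 u.2) + 1

theorem lev_eq (v : ℕ) : G.lev v = (G.view v).ins.sup fun u => G.lev u + 1 := by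
  rw [lev, WellFounded.fix_eq, ← lev]
  exact Finset.sup_attach (G.view v).ins fun u => G.lev u + 1

theorem lev_lt {u v : ℕ} (h : (u, v) ∈ G.edges) : G.lev u < G.lev v := by
  rw [G.lev_eq v]
  exact Nat.lt_of_succ_le
    (Finset.le_sup (f := fun u => G.lev u + 1) (G.mem_ins.2 h))

/-! ### Splitting off the last edge; path lengths and levels -/

variable {G}

theorem isPath_singleton {x : ℕ} (hx : x ∈ G.verts) : G.IsPath x x [x] := by
  simp [IsPath, hx]

theorem IsPath.concat {x u y : ℕ} {q : List ℕ} (h : G.IsPath x u q) (e : (u, y) ∈ G.edges) :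
    G.IsPath x y (q ++ [y]) := by
  obtain ⟨h1, h2, h3, h4⟩ := h
  refine ⟨?_, ?_, ?_, by simp⟩
  · intro v hv
    rcases List.mem_append.1 hv with hv | hv
    · exact h1 v hv
    · rw [List.mem_singleton.1 hv]
      exact (G.edges_mem _ e).2
  · rw [List.isChain_append]
    refine ⟨h2, by simp, ?_⟩
    intro a ha b hb
    rw [h4] at ha
    simp only [Option.mem_def, Option.some.injEq] at ha
    simp only [List.head?_cons, Option.mem_def, Option.some.injEq] at hb
    subst ha; subst hb; exact e
  · simp [List.head?_append, h3]

theorem pathWeight_concat {u y : ℕ} {q : List ℕ} (h : q.getLast? = some u) :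
    G.pathWeight (q ++ [y]) = G.pathWeight q + G.weight u y := by
  induction q with
  | nil => simp at h
  | cons a l ih =>
    cases l with
    | nil =>
      simp only [List.getLast?_singleton, Option.some.injEq] at h
      subst h
      simp [pathWeight]
    | cons b l =>
      rw [List.getLast?_cons_cons] at h
      have := ih h
      simp only [List.cons_append, pathWeight] at this ⊢
      omega

theorem IsPath.cases {x y : ℕ} {p : List ℕ} (h : G.IsPath x y p) :
    (p = [x] ∧ x = y) ∨ ∃ u q, p = q ++ [y] ∧ G.IsPath x u q ∧ (u, y) ∈ G.edges := by
  obtain ⟨h1, h2, h3, h4⟩ := h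
  rcases List.eq_nil_or_concat p with rfl | ⟨q, b, rfl⟩
  · simp at h3
  · rw [List.concat_eq_append] at *
    simp only [List.getLast?_append, List.getLast?_singleton, Option.some_or,
      Option.some.injEq] at h4
    subst h4
    rcases hq : q.getLast? with _ | u
    · rw [List.getLast?_eq_none_iff] at hq
      subst hq
      simp only [List.nil_append, List.head?_cons, Option.some.injEq] at h3
      subst h3
      exact Or.inl ⟨rfl, rfl⟩
    · refine Or.inr ⟨u, q, rfl, ⟨fun v hv => h1 v (List.mem_append_left _ hv), ?_, ?_, hq⟩, ?_⟩
      · exact (List.isChain_append.1 h2).1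
      · have : q ≠ [] := by rintro rfl; simp at hq
        rwa [List.head?_append_of_ne_nil _ this] at h3
      · exact (List.isChain_append.1 h2).2.2 u (by simp [hq]) b (by simp)

theorem IsPath.reflTransGen {x y : ℕ} {p : List ℕ} (h : G.IsPath x y p) :
    Relation.ReflTransGen (fun a b => (a, b) ∈ G.edges) x y := by
  induction y using G.wellFounded_edges.induction generalizing p with
  | _ y ih =>
    rcases h.cases with ⟨-, rfl⟩ | ⟨u, q, -, hq, e⟩
    · exact .refl
    · exact (ih u e hq).tail e

theorem IsPath.nodup {x y : ℕ} {p : List ℕ} (h : G.IsPath x y p) : p.Nodup := by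
  let r : ℕ → ℕ → Prop := Relation.TransGen fun a b => (a, b) ∈ G.edges
  have : Trans r r r := ⟨Relation.TransGen.trans⟩
  have h2 : p.IsChain r := h.2.1.imp fun a b => Relation.TransGen.single
  refine (List.isChain_iff_pairwise.1 h2).imp ?_
  rintro a b hab rfl
  exact G.acyclic a hab

theorem IsPath.length_le {x y : ℕ} {p : List ℕ} (h : G.IsPath x y p) : p.length ≤ G.n := by
  rw [← List.toFinset_card_of_nodup h.nodup]
  exact Finset.card_le_card fun v hv => h.1 v (List.mem_toFinset.1 hv)

theorem IsPath.length_le_longest {x y k : ℕ} {p : List ℕ} (h : G.IsPath x y p)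
    (hk : p.length = k + 1) : k ≤ G.longest := by
  refine le_csSup ⟨G.n, ?_⟩ ⟨x, y, p, h, hk⟩
  rintro k ⟨x, y, p, h, hk⟩
  have := h.length_le
  omega

/-- Going back to an incoming neighbor that attains the supremum, as long as there is one, traces
such a path; this bounds levels by `longest`. -/
theorem exists_path_lev {v : ℕ} (hv : v ∈ G.verts) :
    ∃ x p, G.IsPath x v p ∧ p.length = G.lev v + 1 := by
  induction v using G.wellFounded_edges.induction with
  | _ v ih =>
    rcases (G.view v).ins.eq_empty_or_nonempty with h | h
    · refine ⟨v, [v], isPath_singleton hv, ?_⟩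
      rw [lev_eq, h]; simp
    · obtain ⟨u, hu, hu'⟩ := Finset.exists_mem_eq_sup _ h fun u => G.lev u + 1
      rw [mem_ins] at hu
      obtain ⟨x, p, hp, hl⟩ := ih u hu (G.edges_mem _ hu).1
      refine ⟨x, p ++ [v], hp.concat hu, ?_⟩
      rw [lev_eq, hu', List.length_append, hl]; rfl

theorem lev_le_longest {v : ℕ} (hv : v ∈ G.verts) : G.lev v ≤ G.longest := by
  obtain ⟨x, p, hp, hl⟩ := exists_path_lev hv
  exact hp.length_le_longest hl

theorem longest_lt_n (h : G.verts.Nonempty) : G.longest < G.n := by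
  obtain ⟨v, hv⟩ := h
  have hne : {k | ∃ x y p, G.IsPath x y p ∧ p.length = k + 1}.Nonempty :=
    ⟨0, v, v, [v], isPath_singleton hv, rfl⟩
  obtain ⟨x, y, p, hp, hl⟩ := Nat.sSup_mem hne ⟨G.n, by
    rintro k ⟨x, y, p, h, hk⟩
    have := h.length_le
    omega⟩
  have := hp.length_le
  change p.length = G.longest + 1 at hl
  omega

theorem IsPath.eq_singleton {x : ℕ} {p : List ℕ} (h : G.IsPath x x p) : p = [x] := by
  rcases h.cases with ⟨h, -⟩ | ⟨u, q, -, hq, e⟩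
  · exact h
  · exact (G.acyclic x (Relation.TransGen.tail' hq.reflTransGen e)).elim

theorem IsPath.mem_right {x y : ℕ} {p : List ℕ} (h : G.IsPath x y p) : y ∈ p :=
  List.mem_of_getLast? h.2.2.2

theorem IsPath.reflTransGen_of_mem {x y v : ℕ} {p : List ℕ} (h : G.IsPath x y p) (hv : v ∈ p) :
    Relation.ReflTransGen (fun a b => (a, b) ∈ G.edges) v y := by
  induction y using G.wellFounded_edges.induction generalizing p with
  | _ y ih =>
    rcases h.cases with ⟨rfl, rfl⟩ | ⟨u, q, rfl, hq, e⟩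
    · rw [List.mem_singleton.1 hv]
    · rcases List.mem_append.1 hv with hv | hv
      · exact (ih u e hq hv).tail e
      · rw [List.mem_singleton.1 hv]

/-! ## Distances -/

theorem IsPath.dist_le {x y : ℕ} {p : List ℕ} (h : G.IsPath x y p) :
    G.dist x y ≤ G.pathWeight p :=
  iInf₂_le p h

theorem exists_path_of_dist_ne_top {x y : ℕ} (h : G.dist x y ≠ ⊤) : ∃ p, G.IsPath x y p := by
  by_contra! hp
  apply h
  simp [dist, hp]

theorem exists_shortest {x y : ℕ} (h : G.dist x y ≠ ⊤) :
    ∃ p, G.IsPath x y p ∧ (G.pathWeight p : ℕ∞) = G.dist x y := by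
  obtain ⟨p, hp, hmin⟩ := (measure G.pathWeight).wf.has_min {p | G.IsPath x y p}
    (exists_path_of_dist_ne_top h)
  refine ⟨p, hp, le_antisymm (le_iInf₂ fun q hq => ?_) hp.dist_le⟩
  exact_mod_cast not_lt.1 (hmin q hq)

theorem mem_shortestPaths {x y : ℕ} {p : List ℕ} :
    p ∈ G.shortestPaths x y ↔ G.IsPath x y p ∧ (G.pathWeight p : ℕ∞) = G.dist x y := by
  refine and_congr_right fun hp => ⟨fun h => ?_, fun h q hq => ?_⟩
  · refine le_antisymm (le_iInf₂ fun q hq => ?_) hp.dist_le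
    exact_mod_cast h q hq
  · exact_mod_cast h ▸ hq.dist_le

theorem dist_self {x : ℕ} (hx : x ∈ G.verts) : G.dist x x = 0 := by
  simpa [pathWeight] using (isPath_singleton hx).dist_le

theorem dist_le_of_edge {x u y : ℕ} (e : (u, y) ∈ G.edges) :
    G.dist x y ≤ G.dist x u + (G.weight u y : ℕ∞) := by
  by_cases h : G.dist x u = ⊤
  · simp [h]
  · obtain ⟨p, hp, hw⟩ := exists_shortest h
    rw [← hw, ← Nat.cast_add, ← pathWeight_concat hp.2.2.2]
    exact (hp.concat e).dist_le

theorem exists_pred {x y : ℕ} (h : G.dist x y ≠ ⊤) (hxy : x ≠ y) :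
    ∃ u, (u, y) ∈ G.edges ∧ G.dist x u + (G.weight u y : ℕ∞) = G.dist x y := by
  obtain ⟨p, hp, hw⟩ := exists_shortest h
  rcases hp.cases with ⟨-, h⟩ | ⟨u, q, rfl, hq, e⟩
  · exact (hxy h).elim
  · refine ⟨u, e, le_antisymm ?_ (dist_le_of_edge e)⟩
    rw [← hw, pathWeight_concat hq.2.2.2, Nat.cast_add]
    gcongr
    exact hq.dist_le

theorem dist_eq_inf {x y : ℕ} (hxy : x ≠ y) :
    G.dist x y = (G.view y).ins.inf fun u => G.dist x u + (G.weight u y : ℕ∞) := by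
  refine le_antisymm (Finset.le_inf fun u hu => dist_le_of_edge (G.mem_ins.1 hu)) ?_
  by_cases h : G.dist x y = ⊤
  · rw [h]; exact le_top
  · obtain ⟨u, e, he⟩ := exists_pred h hxy
    rw [← he]
    exact Finset.inf_le (f := fun u => G.dist x u + (G.weight u y : ℕ∞)) (G.mem_ins.2 e)

theorem mem_preds {x y u : ℕ} : u ∈ G.preds x y ↔ (u, y) ∈ G.edges ∧ G.dist x y ≠ ⊤ ∧
    G.dist x u + (G.weight u y : ℕ∞) = G.dist x y := by
  simp only [preds, Finset.mem_filter, and_iff_right_iff_imp]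
  exact fun h => (G.edges_mem _ h.1).1

/-- A predecessor would be reachable from `x` and have an edge to `x`, closing a cycle. -/
theorem preds_self (x : ℕ) : G.preds x x = ∅ := by
  ext u
  rw [mem_preds]
  simp only [Finset.notMem_empty, iff_false]
  rintro ⟨e, h, h'⟩
  obtain ⟨p, hp⟩ := exists_path_of_dist_ne_top (G := G) (x := x) (y := u) fun hu => by
    rw [hu, top_add] at h'
    exact h h'.symm
  exact G.acyclic x (Relation.TransGen.tail' hp.reflTransGen e)

theorem dist_eq_top_of_edge {x u : ℕ} (e : (u, x) ∈ G.edges) : G.dist x u = ⊤ := by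
  by_contra h
  obtain ⟨p, hp⟩ := exists_path_of_dist_ne_top h
  exact G.acyclic x (Relation.TransGen.tail' hp.reflTransGen e)

/-! ## Counting shortest paths -/

theorem shortestPaths_self {x : ℕ} (hx : x ∈ G.verts) : G.shortestPaths x x = {[x]} := by
  ext p
  rw [mem_shortestPaths, dist_self hx, Set.mem_singleton_iff]
  constructor
  · exact fun h => h.1.eq_singleton
  · rintro rfl
    exact ⟨isPath_singleton hx, by simp [pathWeight]⟩

/-- A shortest path without its last edge is still shortest: the weight of that edge is finite and
can be cancelled. -/
theorem shortestPaths_eq_biUnion {x y : ℕ} (hxy : x ≠ y) :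
    G.shortestPaths x y = ⋃ u ∈ G.preds x y, (· ++ [y]) '' G.shortestPaths x u := by
  ext p
  simp only [Set.mem_iUnion, Set.mem_image, exists_prop, mem_shortestPaths, mem_preds]
  constructor
  · rintro ⟨hp, hw⟩
    rcases hp.cases with ⟨-, h⟩ | ⟨u, q, rfl, hq, e⟩
    · exact (hxy h).elim
    · rw [pathWeight_concat hq.2.2.2, Nat.cast_add] at hw
      have h1 : G.dist x u + (G.weight u y : ℕ∞) ≤ G.dist x y := by
        rw [← hw]
        gcongr
        exact hq.dist_le
      have h2 := le_antisymm h1 (dist_le_of_edge e)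
      refine ⟨u, ⟨e, ?_, h2⟩, q, ⟨hq, ?_⟩, rfl⟩
      · rw [← hw, ← Nat.cast_add]
        exact ENat.natCast_ne_top _
      · rw [← h2] at hw
        exact WithTop.add_right_cancel (ENat.natCast_ne_top _) hw
  · rintro ⟨u, ⟨e, -, h⟩, q, ⟨hq, hw⟩, rfl⟩
    refine ⟨hq.concat e, ?_⟩
    rw [pathWeight_concat hq.2.2.2, Nat.cast_add, hw, h]

theorem finite_shortestPaths (x y : ℕ) : (G.shortestPaths x y).Finite := by
  induction y using G.wellFounded_edges.induction with
  | _ y ih =>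
    by_cases hxy : x = y
    · subst hxy
      exact (Set.finite_singleton [x]).subset fun p hp => hp.1.eq_singleton
    · rw [shortestPaths_eq_biUnion hxy]
      exact (G.preds x y).finite_toSet.biUnion fun u hu => (ih u (mem_preds.1 hu).1).image _

/-- One recursion for two counts: with `Q` trivial it gives `numSP`, with `Q` saying that the path
meets some `v ≠ y` it gives `numSPThrough`. -/
theorem ncard_shortestPaths {x y : ℕ} (hxy : x ≠ y) (Q : List ℕ → Prop)
    (hQ : ∀ q, Q (q ++ [y]) ↔ Q q) :
    {p ∈ G.shortestPaths x y | Q p}.ncard =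
      ∑ u ∈ G.preds x y, {p ∈ G.shortestPaths x u | Q p}.ncard := by
  have h1 : {p ∈ G.shortestPaths x y | Q p} =
      ⋃ u ∈ (G.preds x y : Set ℕ), (· ++ [y]) '' {p ∈ G.shortestPaths x u | Q p} := by
    rw [shortestPaths_eq_biUnion hxy]
    ext p
    simp only [Set.mem_ofPred_eq, Set.mem_iUnion, Set.mem_image, exists_prop, Finset.mem_coe]
    constructor
    · rintro ⟨⟨u, hu, q, hq, rfl⟩, h⟩
      exact ⟨u, hu, q, ⟨hq, (hQ q).1 h⟩, rfl⟩
    · rintro ⟨u, hu, q, ⟨hq, h⟩, rfl⟩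
      exact ⟨⟨u, hu, q, hq, rfl⟩, (hQ q).2 h⟩
  have hinj : Function.Injective fun q : List ℕ => q ++ [y] := List.append_left_injective [y]
  rw [h1, Set.Finite.ncard_biUnion (G.preds x y).finite_toSet, finsum_mem_coe_finset]
  · exact Finset.sum_congr rfl fun u _ => Set.ncard_image_of_injective _ hinj
  · exact fun u _ => ((finite_shortestPaths x u).subset (Set.sep_subset _ _)).image _
  -- Paths with different predecessors differ because the last vertex of the prefix is determined.
  · intro u _ v _ huv
    rw [Function.onFun, Set.disjoint_left]
    rintro _ ⟨q, hq, rfl⟩ ⟨q', hq', h⟩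
    have := hinj h
    subst this
    have h2 := hq.1.1.2.2.2
    rw [hq'.1.1.2.2.2] at h2
    exact huv (Option.some.inj h2).symm

theorem numSP_self {x : ℕ} (hx : x ∈ G.verts) : G.numSP x x = 1 := by
  rw [numSP, shortestPaths_self hx, Set.ncard_singleton]

theorem numSP_eq_sum {x y : ℕ} (hxy : x ≠ y) :
    G.numSP x y = ∑ u ∈ G.preds x y, G.numSP x u := by
  simpa [numSP] using ncard_shortestPaths (G := G) hxy (fun _ => True) (by simp)

theorem numSPThrough_eq_sum {x y v : ℕ} (hvy : v ≠ y) :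
    G.numSPThrough x y v = ∑ u ∈ G.preds x y, G.numSPThrough x u v := by
  by_cases hxy : x = y
  · subst hxy
    rw [preds_self, Finset.sum_empty, numSPThrough, Set.ncard_eq_zero
      ((finite_shortestPaths x x).subset (Set.sep_subset _ _))]
    ext p
    simp only [Set.mem_ofPred_eq, Set.mem_empty_iff_false, iff_false, not_and]
    rintro h hv
    rw [h.1.eq_singleton, List.mem_singleton] at hv
    exact hvy hv
  · refine ncard_shortestPaths hxy (fun p => v ∈ p) fun q => ?_
    simp [hvy]

theorem numSPThrough_right (x v : ℕ) : G.numSPThrough x v v = G.numSP x v := by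
  rw [numSPThrough, numSP]
  congr 1
  ext p
  simp only [Set.mem_ofPred_eq, and_iff_left_iff_imp]
  exact fun h => h.1.mem_right

theorem numSPThrough_of_edge {x u t : ℕ} (e : (u, t) ∈ G.edges) : G.numSPThrough x u t = 0 := by
  rw [numSPThrough, Set.ncard_eq_zero
    ((finite_shortestPaths x u).subset (Set.sep_subset _ _))]
  ext p
  simp only [Set.mem_ofPred_eq, Set.mem_empty_iff_false, iff_false, not_and]
  intro h ht
  exact G.acyclic t (Relation.TransGen.tail' (h.1.reflTransGen_of_mem ht) e)

theorem numSP_ne_zero {x y : ℕ} (h : G.dist x y ≠ ⊤) : G.numSP x y ≠ 0 := by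
  obtain ⟨p, hp⟩ := exists_shortest h
  exact Set.ncard_ne_zero_of_mem (mem_shortestPaths.2 hp) (finite_shortestPaths x y)

theorem numSP_eq_zero {x y : ℕ} (h : G.dist x y = ⊤) : G.numSP x y = 0 := by
  rw [numSP, Set.ncard_eq_zero (finite_shortestPaths x y)]
  ext p
  rw [mem_shortestPaths, h]
  simp

/-! ## The dependency recursion -/

/-- The successors of `v` in the shortest path dag of the source `s`. -/
noncomputable def succs (G : WDag) (s v : ℕ) : Finset ℕ :=
  {w ∈ (G.view v).outs | v ∈ G.preds s w}

theorem mem_succs {s v w : ℕ} : w ∈ G.succs s v ↔ v ∈ G.preds s w := by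
  simp only [succs, Finset.mem_filter, mem_outs, and_iff_right_iff_imp]
  exact fun h => (mem_preds.1 h).1

/-- After `v ≠ t` a shortest path moves on to a successor `w`, and a fraction σ_sv / σ_sw of the
shortest paths through `w` comes from `v`. Instead of cutting paths into pieces, the proof expands
both sides over the predecessors of `t`. -/
theorem numSPThrough_eq_sum_succs (s v : ℕ) {t : ℕ} (hvt : v ≠ t) :
    (G.numSPThrough s t v : ℚ) =
      ∑ w ∈ G.succs s v, (G.numSP s v : ℚ) / G.numSP s w * G.numSPThrough s t w := by
  induction t using G.wellFounded_edges.induction with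
  | _ t ih =>
    -- The induction hypothesis for `u ≠ v`, without the summand `w = t`, which vanishes because no
    -- shortest path to `u` contains `t`. For `u = v` the hypothesis is not available; there all
    -- paths count and the sum is zero.
    have key : ∀ u ∈ G.preds s t, (G.numSPThrough s u v : ℚ) =
        (∑ w ∈ (G.succs s v).erase t, (G.numSP s v : ℚ) / G.numSP s w * G.numSPThrough s u w) +
          if u = v then (G.numSP s v : ℚ) else 0 := by
      intro u hu
      have hut := (mem_preds.1 hu).1
      split_ifs with huv
      · subst huv
        rw [numSPThrough_right, Finset.sum_eq_zero, zero_add]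
        intro w hw
        rw [Finset.mem_erase, mem_succs] at hw
        rw [numSPThrough_of_edge (mem_preds.1 hw.2).1, Nat.cast_zero, mul_zero]
      · rw [ih u hut (Ne.symm huv), add_zero]
        by_cases ht : t ∈ G.succs s v
        · rw [← Finset.add_sum_erase _ _ ht, numSPThrough_of_edge hut, Nat.cast_zero, mul_zero,
            zero_add]
        · rw [Finset.erase_eq_of_notMem ht]
    rw [numSPThrough_eq_sum hvt, Nat.cast_sum, Finset.sum_congr rfl key, Finset.sum_add_distrib,
      Finset.sum_comm]
    have h1 : ∀ w ∈ (G.succs s v).erase t,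
        ∑ u ∈ G.preds s t, (G.numSP s v : ℚ) / G.numSP s w * G.numSPThrough s u w =
          (G.numSP s v : ℚ) / G.numSP s w * G.numSPThrough s t w := by
      intro w hw
      rw [numSPThrough_eq_sum (Finset.ne_of_mem_erase hw), Nat.cast_sum, Finset.mul_sum]
    rw [Finset.sum_congr rfl h1, Finset.sum_ite_eq']
    -- If `v` precedes `t`, the extra term σ_sv is exactly the omitted summand `w = t`.
    by_cases hv : v ∈ G.preds s t
    · rw [if_pos hv, ← Finset.add_sum_erase _ _ (mem_succs.2 hv), numSPThrough_right,
        div_mul_cancel₀, add_comm]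
      exact_mod_cast numSP_ne_zero (mem_preds.1 hv).2.1
    · rw [if_neg hv, Finset.erase_eq_of_notMem fun h => hv (mem_succs.1 h), add_zero]

/-- The 1 is the target `t = w`, since every shortest path to `w` passes through `w`. -/
theorem one_add_dependency {s w : ℕ} (hsw : s ≠ w) (h : G.dist s w ≠ ⊤) :
    1 + G.dependency s w =
      ∑ t ∈ G.verts.erase s, (G.numSPThrough s t w : ℚ) / G.numSP s t := by
  have hw : w ∈ G.verts.erase s := by
    obtain ⟨p, hp⟩ := exists_path_of_dist_ne_top h
    exact Finset.mem_erase.2 ⟨hsw.symm, hp.1 w hp.mem_right⟩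
  rw [← Finset.add_sum_erase _ _ hw, numSPThrough_right, div_self, dependency]
  · congr 2
    ext t
    simp only [Finset.mem_sdiff, Finset.mem_insert, Finset.mem_singleton, Finset.mem_erase]
    tauto
  · exact_mod_cast numSP_ne_zero h

/-- Brandes' recursion: divide `numSPThrough_eq_sum_succs` by σ_st, sum over the targets and
exchange the sums. -/
theorem dependency_eq_sum (s v : ℕ) :
    G.dependency s v = ∑ w ∈ G.succs s v,
      (G.numSP s v : ℚ) * ((1 + G.dependency s w) / G.numSP s w) := by
  have h1 : ∀ w ∈ G.succs s v, (G.numSP s v : ℚ) * ((1 + G.dependency s w) / G.numSP s w) =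
      ∑ t ∈ G.verts \ {v, s},
        (G.numSP s v : ℚ) / G.numSP s w * G.numSPThrough s t w / G.numSP s t := by
    intro w hw
    rw [mem_succs] at hw
    have hw' := mem_preds.1 hw
    have hsw : s ≠ w := by
      rintro rfl
      rw [preds_self] at hw
      exact Finset.notMem_empty _ hw
    rw [one_add_dependency hsw hw'.2.1, mul_div_assoc', mul_div_right_comm, Finset.mul_sum]
    -- The target `t = v` may be dropped: a shortest path to `v` cannot meet the later vertex `w`.
    rw [← Finset.sum_subset (s₁ := G.verts \ {v, s})]
    · exact Finset.sum_congr rfl fun t _ => by rw [mul_div_assoc]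
    · intro t
      simp only [Finset.mem_sdiff, Finset.mem_insert, Finset.mem_singleton, Finset.mem_erase]
      tauto
    · intro t ht ht'
      have : t = v := by
        simp only [Finset.mem_sdiff, Finset.mem_insert, Finset.mem_singleton,
          Finset.mem_erase] at ht ht'
        tauto
      rw [this, numSPThrough_of_edge hw'.1]
      simp
  rw [Finset.sum_congr rfl h1, Finset.sum_comm, dependency]
  refine Finset.sum_congr rfl fun t ht => ?_
  rw [numSPThrough_eq_sum_succs s v, Finset.sum_div]
  rintro rfl
  simp at ht

/-- The definition of `bc` also has the pairs with `t = s`; they contribute 0, as the only path from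
`s` to `s` misses `v`. -/
theorem bc_eq_sum (v : ℕ) : G.bc v = ∑ s ∈ G.verts.erase v, G.dependency s v := by
  refine Finset.sum_congr rfl fun s hs => ?_
  have hs' := Finset.mem_erase.1 hs
  rw [← Finset.add_sum_erase _ _ (Finset.mem_erase.2 hs'), numSPThrough_eq_sum hs'.1.symm,
    preds_self, Finset.sum_empty, Nat.cast_zero, zero_div, zero_add, dependency]
  congr 1
  ext t
  simp only [Finset.mem_sdiff, Finset.mem_insert, Finset.mem_singleton, Finset.mem_erase]
  tauto

theorem dependency_eq_zero {s v : ℕ} (h : G.dist s v = ⊤) : G.dependency s v = 0 := by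
  rw [dependency_eq_sum, numSP_eq_zero h]
  simp

/-! ### Largest reachable levels and the times at which they are known -/

variable (G) in
theorem wellFounded_edges_swap : WellFounded fun a b => (b, a) ∈ G.edges := by
  let r : ℕ → ℕ → Prop := fun a b => Relation.TransGen (fun a b => (a, b) ∈ G.edges) b a
  have : IsStrictOrder ℕ r :=
    { irrefl := G.acyclic, trans := fun _ _ _ h h' => Relation.TransGen.trans h' h }
  have h := Set.wellFoundedOn_iff.1 (G.verts.wellFoundedOn (r := r))
  refine Subrelation.wf (fun {a b} hab => ?_) h
  exact ⟨Relation.TransGen.single hab, (G.edges_mem _ hab).2, (G.edges_mem _ hab).1⟩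

variable (G) in
/-- The largest level of a node reachable from a node. -/
noncomputable def topLev : ℕ → ℕ :=
  G.wellFounded_edges_swap.fix fun v ih =>
    max (G.lev v) ((G.view v).outs.attach.sup fun w => ih w.1 (G.mem_outs.1 w.2))

variable (G) in
/-- The round in which a node knows the largest level of a node reachable from it. -/
noncomputable def topTime : ℕ → ℕ :=
  G.wellFounded_edges_swap.fix fun v ih =>
    max (G.lev v) ((G.view v).outs.attach.sup fun w => ih w.1 (G.mem_outs.1 w.2) + 1)

theorem topLev_eq (v : ℕ) : G.topLev v = max (G.lev v) ((G.view v).outs.sup G.topLev) := by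
  rw [topLev, WellFounded.fix_eq, ← topLev]
  exact congrArg _ (Finset.sup_attach (G.view v).outs G.topLev)

theorem topTime_eq (v : ℕ) :
    G.topTime v = max (G.lev v) ((G.view v).outs.sup fun w => G.topTime w + 1) := by
  rw [topTime, WellFounded.fix_eq, ← topTime]
  exact congrArg _ (Finset.sup_attach (G.view v).outs fun w => G.topTime w + 1)

theorem lev_le_topLev (v : ℕ) : G.lev v ≤ G.topLev v := by
  rw [topLev_eq]; exact le_max_left _ _

theorem lev_le_topTime (v : ℕ) : G.lev v ≤ G.topTime v := by
  rw [topTime_eq]; exact le_max_left _ _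

theorem topLev_le {v w : ℕ} (h : (v, w) ∈ G.edges) : G.topLev w ≤ G.topLev v := by
  rw [G.topLev_eq v]
  exact le_max_of_le_right (Finset.le_sup (G.mem_outs.2 h))

/-- A step back along an edge costs one round and lowers the level by at least one, so it is paid
for by `lev`. Hence the `top` message precedes every accumulation message, the earliest of which is
due no sooner than n + 2 `topLev` - `lev`. -/
theorem topTime_add_lev_le (v : ℕ) : G.topTime v + G.lev v ≤ 2 * G.topLev v := by
  induction v using G.wellFounded_edges_swap.induction with
  | _ v ih =>
    have h0 := G.lev_le_topLev v
    have h1 : G.topTime v ≤ 2 * G.topLev v - G.lev v := by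
      rw [topTime_eq]
      refine max_le (by omega) (Finset.sup_le fun w hw => ?_)
      rw [mem_outs] at hw
      have := ih w hw
      have := topLev_le hw
      have := G.lev_lt hw
      omega
    omega

theorem topLev_le_longest {v : ℕ} (hv : v ∈ G.verts) : G.topLev v ≤ G.longest := by
  induction v using G.wellFounded_edges_swap.induction with
  | _ v ih =>
    rw [topLev_eq]
    refine max_le (lev_le_longest hv) (Finset.sup_le fun w hw => ?_)
    rw [mem_outs] at hw
    exact ih w hw (G.edges_mem _ hw).2

theorem lev_lt_longest {v w : ℕ} (h : (v, w) ∈ G.edges) : G.lev v < G.longest :=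
  (G.lev_lt h).trans_le (lev_le_longest (G.edges_mem _ h).2)

end WDag

/-! # Ranks in a finite set -/

section Rank

variable {α : Type} [LinearOrder α]

/-- The position of `a` in the ordered list of the elements of `F`. -/
def place (F : Finset α) (a : α) : ℕ := {z ∈ F | z ≤ a}.card

theorem place_pos {F : Finset α} {a : α} (h : a ∈ F) : 0 < place F a :=
  Finset.card_pos.2 ⟨a, by simp [h]⟩

theorem place_le_card (F : Finset α) (a : α) : place F a ≤ F.card :=
  Finset.card_le_card (Finset.filter_subset _ _)

theorem place_mono (F : Finset α) {a b : α} (h : a ≤ b) : place F a ≤ place F b := by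
  refine Finset.card_le_card fun z hz => ?_
  rw [Finset.mem_filter] at hz ⊢
  exact ⟨hz.1, hz.2.trans h⟩

theorem place_lt {F : Finset α} {a b : α} (hb : b ∈ F) (h : a < b) : place F a < place F b := by
  refine Finset.card_lt_card ?_
  rw [Finset.ssubset_iff_of_subset]
  · exact ⟨b, by simp [hb], by simp [h]⟩
  · intro z hz
    rw [Finset.mem_filter] at hz ⊢
    exact ⟨hz.1, hz.2.trans h.le⟩

theorem place_injOn (F : Finset α) : Set.InjOn (place F) F := by
  intro a ha b hb h
  rcases lt_trichotomy a b with hab | hab | hab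
  · exact absurd h (place_lt hb hab).ne
  · exact hab
  · exact absurd h (place_lt ha hab).ne'

theorem image_place (F : Finset α) : F.image (place F) = Finset.Icc 1 F.card := by
  refine Finset.eq_of_subset_of_card_le ?_ ?_
  · intro i hi
    obtain ⟨a, ha, rfl⟩ := Finset.mem_image.1 hi
    exact Finset.mem_Icc.2 ⟨place_pos ha, place_le_card F a⟩
  · rw [Finset.card_image_of_injOn (place_injOn F)]
    simp

theorem mem_of_pick {F : Finset α} {a : α} (h : pick F = some a) : a ∈ F := by
  rw [pick] at h
  exact (Finset.mem_sort _).1 (List.mem_of_head? h)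

theorem pick_eq_none {F : Finset α} : pick F = none ↔ F = ∅ := by
  rw [pick, List.head?_eq_none_iff, ← List.length_eq_zero_iff, Finset.length_sort,
    Finset.card_eq_zero]

theorem pick_eq_some {F : Finset α} {a : α} (h : a ∈ F) (h' : ∀ b ∈ F, b = a) :
    pick F = some a := by
  rcases hp : pick F with _ | b
  · rw [pick_eq_none.1 hp] at h
    exact (Finset.notMem_empty _ h).elim
  · rw [h' b (mem_of_pick hp)]

end Rank

/-! # Runs without termination -/

namespace WDag

variable {G : WDag}

theorem Linked.mem_left {u v : ℕ} (h : G.Linked u v) : u ∈ G.verts :=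
  h.elim (fun e => (G.edges_mem _ e).1) fun e => (G.edges_mem _ e).2

theorem Linked.mem_right {u v : ℕ} (h : G.Linked u v) : v ∈ G.verts :=
  h.elim (fun e => (G.edges_mem _ e).2) fun e => (G.edges_mem _ e).1

end WDag

namespace DistAlg

variable {Input Msg Out : Type}

/-- `F t v` is the state of the node `v` after `t` rounds if the nodes start in the states `st`
and never stop. -/
structure IsRun (A : DistAlg Input Msg Out) (G : WDag) (st : ℕ → A.State)
    (F : ℕ → ℕ → A.State) : Prop where
  zero : ∀ v ∈ G.verts, F 0 v = st v
  succ : ∀ t, ∀ v ∈ G.verts, F (t + 1) v =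
    A.recv (F t v) fun u => if G.Linked u v then A.send (F t u) v else none

/-- In the run `F` without termination, a node sends nothing after its termination. -/
def Quiet (A : DistAlg Input Msg Out) (G : WDag) (F : ℕ → ℕ → A.State) : Prop :=
  ∀ t v, (A.output (F t v)).isSome → ∀ t' ≥ t, ∀ w, G.Linked v w → A.send (F t' v) w = none

variable {A : DistAlg Input Msg Out} {G : WDag} {inp : ℕ → Input} {F : ℕ → ℕ → A.State}

/-- A running node is in its state of the endless run; a stopped one sends nothing, and by `Quiet`
the endless run sends nothing either. -/
theorem sentBy_eq_of_states (H : A.Quiet G F) {t u : ℕ}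
    (h : u ∈ G.verts → (A.output (A.states G inp t u) = none ∧ A.states G inp t u = F t u) ∨
      ∃ t₀ ≤ t, A.states G inp t u = F t₀ u ∧ (A.output (F t₀ u)).isSome) (v : ℕ) :
    A.sentBy G (A.states G inp t) u v =
      if G.Linked u v then A.send (F t u) v else none := by
  rw [sentBy]
  by_cases huv : G.Linked u v
  · rcases h (WDag.Linked.mem_left huv) with ⟨h, h'⟩ | ⟨t₀, ht, h', h⟩
    · rw [if_pos ⟨huv, by simp [h]⟩, if_pos huv, h']
    · rw [if_neg, if_pos huv, H t₀ u h t ht v huv]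
      rw [h']
      intro hc
      have := hc.2
      rw [Option.isNone_iff_eq_none] at this
      simp [this] at h
  · rw [if_neg fun hc => huv hc.1, if_neg huv]

/-- By induction on `t` all inboxes agree with those of the endless run, so a node follows `F` until
it stops and then keeps that state. -/
theorem states_cases (hF : A.IsRun G (fun v => A.init (inp v)) F) (H : A.Quiet G F) (t : ℕ)
    {v : ℕ} (hv : v ∈ G.verts) :
    (A.output (A.states G inp t v) = none ∧ A.states G inp t v = F t v) ∨
      ∃ t₀ ≤ t, A.states G inp t v = F t₀ v ∧ (A.output (F t₀ v)).isSome := by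
  induction t generalizing v with
  | zero =>
    have key : A.states G inp 0 v = F 0 v := (hF.zero v hv).symm
    rcases ho : A.output (A.states G inp 0 v) with _ | o
    · exact Or.inl ⟨rfl, key⟩
    · exact Or.inr ⟨0, le_rfl, key, by rw [← key, ho]; rfl⟩
  | succ t ih =>
    rcases ih hv with ⟨h, h'⟩ | ⟨t₀, ht, h', h⟩
    · have key : A.states G inp (t + 1) v = F (t + 1) v := by
        rw [states, round, if_pos (by simp [h]), hF.succ t v hv, h']
        congr 1
        funext u
        exact sentBy_eq_of_states H ih v
      rcases ho : A.output (A.states G inp (t + 1) v) with _ | o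
      · exact Or.inl ⟨rfl, key⟩
      · exact Or.inr ⟨t + 1, le_rfl, key, by rw [← key, ho]; rfl⟩
    · refine Or.inr ⟨t₀, ht.trans (Nat.le_succ t), ?_, h⟩
      rw [states, round, if_neg, h']
      rw [h', Option.isNone_iff_eq_none]
      intro hn
      simp [hn] at h

theorem sent_eq (hF : A.IsRun G (fun v => A.init (inp v)) F) (H : A.Quiet G F) (t u v : ℕ) :
    A.sent G inp t u v = if G.Linked u v then A.send (F t u) v else none :=
  sentBy_eq_of_states H (states_cases hF H t) v

theorem messages_le (hF : A.IsRun G (fun v => A.init (inp v)) F) (H : A.Quiet G F) {T a b : ℕ}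
    (ha : ∀ u v, (u, v) ∈ G.edges →
      {t ∈ Finset.range T | (A.send (F t u) v).isSome}.card ≤ a)
    (hb : ∀ u v, (u, v) ∈ G.edges →
      {t ∈ Finset.range T | (A.send (F t v) u).isSome}.card ≤ b) :
    A.messages G inp T ≤ G.m * (a + b) := by
  let f : ℕ × ℕ → ℕ := fun e => {t ∈ Finset.range T | (A.send (F t e.1) e.2).isSome}.card
  have h1 : A.messages G inp T = ∑ e ∈ G.verts ×ˢ G.verts,
      {t ∈ Finset.range T | (A.sent G inp t e.1 e.2).isSome}.card := by
    simp only [messages, Finset.card_filter]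
    exact Finset.sum_comm
  -- An ordered pair is charged to its edge, traversed forwards (bound `a`) or backwards (bound
  -- `b`).
  have h2 : ∀ e ∈ G.verts ×ˢ G.verts,
      {t ∈ Finset.range T | (A.sent G inp t e.1 e.2).isSome}.card ≤
        (if e ∈ G.edges then f e else 0) + if e.swap ∈ G.edges then f e else 0 := by
    intro e _
    by_cases he : G.Linked e.1 e.2
    · have h3 : {t ∈ Finset.range T | (A.sent G inp t e.1 e.2).isSome}.card = f e := by
        simp only [sent_eq hF H, if_pos he, f]
      rw [h3]
      rcases he with he | he
      · rw [if_pos (show e ∈ G.edges from he)]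
        exact Nat.le_add_right _ _
      · rw [if_pos (show e.swap ∈ G.edges from he)]
        exact Nat.le_add_left _ _
    · simp only [sent_eq hF H, if_neg he]
      simp
  rw [h1]
  refine (Finset.sum_le_sum h2).trans ?_
  have hE : G.edges ⊆ G.verts ×ˢ G.verts := fun e he => Finset.mem_product.2 (G.edges_mem e he)
  have h4 : ∑ e ∈ G.verts ×ˢ G.verts, (if e ∈ G.edges then f e else 0) ≤ G.m * a := by
    rw [← Finset.sum_filter, Finset.filter_mem_eq_inter, Finset.inter_eq_right.2 hE, WDag.m,
      ← smul_eq_mul]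
    exact Finset.sum_le_card_nsmul _ _ _ fun e he => ha e.1 e.2 he
  have h5 : ∑ e ∈ G.verts ×ˢ G.verts, (if e.swap ∈ G.edges then f e else 0) ≤ G.m * b := by
    rw [← Finset.sum_filter]
    have h6 : {e ∈ G.verts ×ˢ G.verts | e.swap ∈ G.edges}.card ≤ G.m :=
      Finset.card_le_card_of_injOn Prod.swap (fun e he => (Finset.mem_filter.1 he).2)
        Prod.swap_injective.injOn
    refine (Finset.sum_le_card_nsmul _ _ b fun e he => ?_).trans ?_
    · exact hb e.2 e.1 (Finset.mem_filter.1 he).2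
    · rw [smul_eq_mul]
      exact Nat.mul_le_mul_right _ h6
  rw [Finset.sum_add_distrib, Nat.mul_add]
  exact Nat.add_le_add h4 h5

theorem computes_of_isRun (hF : A.IsRun G (fun v => A.init (inp v)) F) (H : A.Quiet G F)
    {bits : Msg → ℕ} {spec : ℕ → Out → Prop} {T rounds msgs len : ℕ} (hT : T ≤ rounds)
    (hout : ∀ v ∈ G.verts, (A.output (F T v)).isSome)
    (hspec : ∀ v ∈ G.verts, ∀ t o, A.output (F t v) = some o → spec v o)
    (hmsgs : A.messages G inp T ≤ msgs)
    (hlen : ∀ t u v μ, G.Linked u v → A.send (F t u) v = some μ → bits μ ≤ len) :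
    A.Computes bits G inp spec rounds msgs len := by
  refine ⟨T, hT, fun v hv => ?_, hmsgs, fun t u _ v _ μ hμ => ?_⟩
  · rcases states_cases hF H T hv with ⟨h, h'⟩ | ⟨t₀, -, h', h⟩
    · rw [h'] at h
      have := hout v hv
      simp [h] at this
    · obtain ⟨o, ho⟩ := Option.isSome_iff_exists.1 h
      exact ⟨o, by rw [h', ho], hspec v hv t₀ o ho⟩
  · rw [sent_eq hF H] at hμ
    split_ifs at hμ with huv
    exact hlen t u v μ huv hμ

end DistAlg

/-! # The shortest path computation -/

namespace WDag

variable {G : WDag}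

/-- `ids v` is a set of nodes that contains `v` and is closed under adjacency. -/
structure IsIdSets (G : WDag) (ids : ℕ → Finset ℕ) : Prop where
  self_mem : ∀ v ∈ G.verts, v ∈ ids v
  subset : ∀ v ∈ G.verts, ids v ⊆ G.verts
  edge : ∀ u v, (u, v) ∈ G.edges → ids u = ids v

variable {ids : ℕ → Finset ℕ}

/-- Following a path keeps the ID set constant. A source missing from it is therefore truly
unreachable, and the default values for it are correct. -/
theorem IsIdSets.mem_of_dist_ne_top (h : G.IsIdSets ids) {x v : ℕ} (hx : x ∈ G.verts)
    (hd : G.dist x v ≠ ⊤) : x ∈ ids v := by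
  obtain ⟨p, hp⟩ := exists_path_of_dist_ne_top hd
  have := hp.reflTransGen
  have h2 : ids x = ids v := by
    clear hp hd
    induction this with
    | refl => rfl
    | tail _ e ih => rw [ih, h.edge _ _ e]
  rw [← h2]
  exact h.self_mem x hx

open Classical in
/-- The state of a node at time `t` in the APSP computation without termination. -/
noncomputable def coreAt (G : WDag) (ids : ℕ → Finset ℕ) (t v : ℕ) : Core where
  view := G.view v
  ids := ids v
  clock := t
  nbrLevel := fun u => if (u, v) ∈ G.edges ∧ G.lev u < t then some (G.lev u) else none
  levelSent := decide (G.lev v < t)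
  -- Strict inequality: what is sent at time `place + lev u` is stored one tick later.
  got := fun u x =>
    if (u, v) ∈ G.edges ∧ x ∈ ids v ∧ place (ids v) x + G.lev u < t ∧ G.dist x u ≠ ⊤ then
      some ((G.dist x u).toNat, G.numSP x u)
    else none

theorem coreAt_zero (v : ℕ) : G.coreAt ids 0 v = Core.start (G.view v) (ids v) := by
  simp [coreAt, Core.start]

@[simp] theorem coreAt_view (t v : ℕ) : (G.coreAt ids t v).view = G.view v := rfl

@[simp] theorem coreAt_ids (t v : ℕ) : (G.coreAt ids t v).ids = ids v := rfl

@[simp] theorem coreAt_clock (t v : ℕ) : (G.coreAt ids t v).clock = t := rfl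

@[simp] theorem view_self (v : ℕ) : (G.view v).self = v := rfl

theorem coreAt_level? (t v : ℕ) :
    (G.coreAt ids t v).level? = if G.lev v ≤ t then some (G.lev v) else none := by
  have h : (∀ u ∈ (G.view v).ins, ((G.coreAt ids t v).nbrLevel u).isSome) ↔ G.lev v ≤ t := by
    rw [lev_eq, Finset.sup_le_iff]
    refine forall₂_congr fun u hu => ?_
    rw [mem_ins] at hu
    simp [coreAt, hu]
  by_cases ht : G.lev v ≤ t
  · rw [Core.level?, coreAt_view, if_pos (h.2 ht), if_pos ht, G.lev_eq v]
    congr 1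
    refine Finset.sup_congr rfl fun u hu => ?_
    have hu' := G.mem_ins.1 hu
    have := G.lev_lt hu'
    simp [coreAt, hu', show G.lev u < t by omega]
  · rw [Core.level?, coreAt_view, if_neg (fun hc => ht (h.1 hc)), if_neg ht]

/-- The timing argument: `lev u < lev v`, so the message of `u` for `x` has been stored when the
time of `x` comes at `v`. A missing message thus means an infinite distance. -/
theorem coreAt_via {t v x u : ℕ} (hx : x ∈ ids v) (ht : place (ids v) x + G.lev v ≤ t)
    (e : (u, v) ∈ G.edges) :
    (G.coreAt ids t v).via x u = G.dist x u + (G.weight u v : ℕ∞) := by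
  have h1 : place (ids v) x + G.lev u < t := by have := G.lev_lt e; omega
  by_cases h : G.dist x u = ⊤
  · simp only [Core.via, coreAt, h]
    simp
    rfl
  · obtain ⟨d, hd⟩ := ENat.ne_top_iff_exists.1 h
    rw [← hd]
    simp only [Core.via, coreAt, ← hd, e, hx, h1]
    simp [view_wIn, e]
    rfl

theorem coreAt_dist {t v x : ℕ} (hv : v ∈ G.verts) (hx : x ∈ ids v)
    (ht : place (ids v) x + G.lev v ≤ t) : (G.coreAt ids t v).dist x = G.dist x v := by
  rw [Core.dist]
  by_cases hxv : x = v
  · subst hxv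
    rw [dist_self hv]
    simp [coreAt, view]
    rfl
  · rw [if_neg (by simpa using hxv), dist_eq_inf hxv]
    exact Finset.inf_congr rfl fun u hu => coreAt_via hx ht (G.mem_ins.1 hu)

theorem coreAt_preds {t v x : ℕ} (hv : v ∈ G.verts) (hx : x ∈ ids v)
    (ht : place (ids v) x + G.lev v ≤ t) : (G.coreAt ids t v).preds x = G.preds x v := by
  have h0 := coreAt_dist hv hx ht
  ext u
  rw [mem_preds, Core.preds, coreAt_view, view_self]
  split_ifs with h
  · simp only [Finset.notMem_empty, false_iff]
    rintro ⟨e, hd, h'⟩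
    rcases h with rfl | h
    · have : u ∈ G.preds x x := mem_preds.2 ⟨e, hd, h'⟩
      rw [preds_self] at this
      exact Finset.notMem_empty _ this
    · exact hd (h0.symm.trans h)
  · push Not at h
    rw [Finset.mem_filter, mem_ins]
    refine and_congr_right fun e => ?_
    rw [h0, coreAt_via hx ht e]
    exact ⟨fun h' => ⟨fun hd => h.2 (h0.trans hd), h'⟩, fun h' => h'.2⟩

theorem coreAt_count {t v x : ℕ} (hv : v ∈ G.verts) (hx : x ∈ ids v)
    (ht : place (ids v) x + G.lev v ≤ t) : (G.coreAt ids t v).count x = G.numSP x v := by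
  rw [Core.count, coreAt_preds hv hx ht, coreAt_view, view_self]
  by_cases hxv : x = v
  · subst hxv
    rw [if_pos rfl, numSP_self hv]
  · rw [if_neg (by simpa using hxv), numSP_eq_sum hxv]
    refine Finset.sum_congr rfl fun u hu => ?_
    obtain ⟨e, hd, h⟩ := mem_preds.1 hu
    have h1 : place (ids v) x + G.lev u < t := by have := G.lev_lt e; omega
    have h2 : G.dist x u ≠ ⊤ := by
      intro h3
      rw [h3, top_add] at h
      exact hd h.symm
    simp [coreAt, e, hx, h1, h2]

theorem coreAt_send_cases {t v w : ℕ} (e : (v, w) ∈ G.edges) :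
    (G.coreAt ids t v).send w =
      if t = G.lev v then some (.level (G.lev v)) else
      match pick {x ∈ ids v | place (ids v) x + G.lev v = t} with
      | none => none
      | some x => if G.dist x v = ⊤ then none else
          some (.sssp x (G.dist x v).toNat (G.numSP x v)) := by
  have hv := (G.edges_mem _ e).1
  rw [Core.send, if_pos (show w ∈ (G.coreAt ids t v).view.outs from G.mem_outs.2 e),
    coreAt_level?]
  rcases lt_trichotomy t (G.lev v) with h | h | h
  · rw [if_neg (by omega), if_neg h.ne]
    have : pick {x ∈ ids v | place (ids v) x + G.lev v = t} = none := by
      rw [pick_eq_none, Finset.filter_eq_empty_iff]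
      intro x _
      omega
    rw [this]
  · rw [if_pos h.ge, if_pos h]
    simp [coreAt, h]
  · rw [if_pos h.le, if_neg h.ne']
    have h1 : (G.coreAt ids t v).levelSent = true := by simp [coreAt, h]
    simp only [h1, Bool.true_eq_false, if_false]
    -- `newId` is definitionally `place`.
    change (match pick {x ∈ ids v | place (ids v) x + G.lev v = t} with
        | none => none
        | some x => _) = _
    rcases hp : pick {x ∈ ids v | place (ids v) x + G.lev v = t} with _ | x
    · rfl
    · obtain ⟨hx, hxt⟩ := Finset.mem_filter.1 (mem_of_pick hp)
      simp only [coreAt_dist hv hx hxt.le, coreAt_count hv hx hxt.le]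
      by_cases hd : G.dist x v = ⊤
      · rw [hd, if_pos rfl]; rfl
      · rw [if_neg hd]
        obtain ⟨d, hd⟩ := ENat.ne_top_iff_exists.1 hd
        rw [← hd]
        rfl

theorem coreAt_send_of_not_edge {t v w : ℕ} (e : (v, w) ∉ G.edges) :
    (G.coreAt ids t v).send w = none := by
  rw [Core.send, if_neg (show w ∉ (G.coreAt ids t v).view.outs by
    simpa [coreAt] using e)]

theorem coreAt_send_level {t v w l : ℕ} (e : (v, w) ∈ G.edges) :
    (G.coreAt ids t v).send w = some (.level l) ↔ t = G.lev v ∧ l = G.lev v := by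
  rw [coreAt_send_cases e]
  split_ifs with h
  · simp [h, eq_comm]
  · simp only [h, false_and, iff_false]
    split
    · simp
    · split_ifs <;> simp

theorem coreAt_send_sssp {t v w x d c : ℕ} (e : (v, w) ∈ G.edges) :
    (G.coreAt ids t v).send w = some (.sssp x d c) ↔ x ∈ ids v ∧
      place (ids v) x + G.lev v = t ∧ G.dist x v ≠ ⊤ ∧ d = (G.dist x v).toNat ∧
        c = G.numSP x v := by
  rw [coreAt_send_cases e]
  split_ifs with h
  -- Ranks start at 1, so no source is due in the round of the level message.
  · simp only [Option.some.injEq, reduceCtorEq, false_iff]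
    rintro ⟨hx, hxt, -⟩
    have := place_pos hx
    omega
  · constructor
    · intro hs
      rcases hp : pick {x ∈ ids v | place (ids v) x + G.lev v = t} with _ | y
      · simp [hp] at hs
      · obtain ⟨hx, hxt⟩ := Finset.mem_filter.1 (mem_of_pick hp)
        simp only [hp] at hs
        split_ifs at hs with hd
        simp only [Option.some.injEq, Msg.sssp.injEq] at hs
        obtain ⟨rfl, rfl, rfl⟩ := hs
        exact ⟨hx, hxt, hd, rfl, rfl⟩
    · rintro ⟨hx, hxt, hd, rfl, rfl⟩
      -- Different sources have different ranks, so at most one is due.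
      have : pick {x ∈ ids v | place (ids v) x + G.lev v = t} = some x := by
        refine pick_eq_some (Finset.mem_filter.2 ⟨hx, hxt⟩) fun y hy => ?_
        obtain ⟨hy, hyt⟩ := Finset.mem_filter.1 hy
        exact place_injOn (ids v) hy hx (by omega)
      rw [this]
      simp [hd]

theorem coreAt_send_kind {t v w : ℕ} {μ : Msg}
    (h : (G.coreAt ids t v).send w = some μ) :
    (v, w) ∈ G.edges ∧ ((∃ l, μ = .level l) ∨ ∃ x d c, μ = .sssp x d c) := by
  by_cases e : (v, w) ∈ G.edges
  · refine ⟨e, ?_⟩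
    rw [coreAt_send_cases e] at h
    split_ifs at h with h1
    · exact Or.inl ⟨_, (Option.some.inj h).symm⟩
    · split at h
      · simp at h
      · split_ifs at h
        exact Or.inr ⟨_, _, _, (Option.some.inj h).symm⟩
  · rw [coreAt_send_of_not_edge e] at h
    simp at h

/-- The inbox is constrained only as far as `Core.recv` reads it, so that the lemma also serves the
BC algorithm, where messages of other kinds come from outgoing neighbors. -/
theorem coreAt_succ (hI : G.IsIdSets ids) {t v : ℕ} {inbox : ℕ → Option Msg}
    (h1 : ∀ u, (u, v) ∈ G.edges → inbox u = (G.coreAt ids t u).send v)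
    (h2 : ∀ u, (u, v) ∉ G.edges → (∀ l, inbox u ≠ some (.level l)) ∧
      ∀ x d c, inbox u ≠ some (.sssp x d c)) :
    (G.coreAt ids t v).recv inbox = G.coreAt ids (t + 1) v := by
  have hL : ((G.coreAt ids t v).recv inbox).nbrLevel = (G.coreAt ids (t + 1) v).nbrLevel := by
    funext u
    simp only [Core.recv]
    by_cases e : (u, v) ∈ G.edges
    · have h := h1 u e
      split
      · rename_i l hl
        rw [h, coreAt_send_level e] at hl
        simp [coreAt, e, hl]
      · rename_i hl
        have hne : t ≠ G.lev u := fun ht => hl _ (by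
          rw [h, coreAt_send_level e]; exact ⟨ht, rfl⟩)
        have hiff : G.lev u < t + 1 ↔ G.lev u < t := by omega
        simp only [coreAt, hiff]
    · have h := (h2 u e).1
      split
      · rename_i l hl
        exact (h l hl).elim
      · simp [coreAt, e]
  have hG : ((G.coreAt ids t v).recv inbox).got = (G.coreAt ids (t + 1) v).got := by
    funext u x
    simp only [Core.recv]
    by_cases e : (u, v) ∈ G.edges
    · have h := h1 u e
      have hids := hI.edge u v e
      have hstep : (¬ ∃ d c, inbox u = some (.sssp x d c)) →
          (G.coreAt ids t v).got u x = (G.coreAt ids (t + 1) v).got u x := by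
        intro hl
        by_cases hx : x ∈ ids v ∧ G.dist x u ≠ ⊤
        · have hne : place (ids v) x + G.lev u ≠ t := fun ht => hl ⟨_, _, by
            rw [h, coreAt_send_sssp e, hids]; exact ⟨hx.1, ht, hx.2, rfl, rfl⟩⟩
          have hiff : place (ids v) x + G.lev u < t + 1 ↔ place (ids v) x + G.lev u < t := by
            omega
          simp only [coreAt, hiff]
        · simp only [coreAt]
          rw [if_neg (by tauto), if_neg (by tauto)]
      split
      · rename_i x' d c hl
        split_ifs with hx'
        · subst hx'
          rw [h, coreAt_send_sssp e, hids] at hl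
          obtain ⟨hx, ht, hd, rfl, rfl⟩ := hl
          simp only [coreAt]
          rw [if_pos ⟨e, hx, by omega, hd⟩]
        · refine hstep ?_
          rintro ⟨d', c', h'⟩
          rw [hl] at h'
          simp only [Option.some.injEq, Msg.sssp.injEq] at h'
          exact hx' h'.1
      · rename_i hl
        exact hstep fun ⟨d, c, h'⟩ => hl _ _ _ h'
    · have h := (h2 u e).2
      split
      · rename_i x' d c hl
        exact (h _ _ _ hl).elim
      · simp [coreAt, e]
  have hS : ((G.coreAt ids t v).recv inbox).levelSent = (G.coreAt ids (t + 1) v).levelSent := by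
    simp only [Core.recv, coreAt_level?]
    by_cases h : G.lev v ≤ t
    · simp [h, coreAt]
    · simp [h, coreAt]
  calc (G.coreAt ids t v).recv inbox = ⟨_, _, _, ((G.coreAt ids t v).recv inbox).nbrLevel,
        ((G.coreAt ids t v).recv inbox).levelSent, ((G.coreAt ids t v).recv inbox).got⟩ := rfl
    _ = G.coreAt ids (t + 1) v := by rw [hL, hG, hS]; rfl

theorem coreAt_dist_of_notMem {t v x : ℕ} (hI : G.IsIdSets ids) (hv : v ∈ G.verts)
    (hx : x ∉ ids v) : (G.coreAt ids t v).dist x = ⊤ := by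
  have hxv : x ≠ v := fun h => hx (h ▸ hI.self_mem v hv)
  rw [Core.dist, if_neg (by simpa using hxv)]
  refine (Finset.inf_congr rfl fun u _ => ?_).trans (Finset.inf_top _)
  simp [Core.via, coreAt, hx]

/-- The final results of the APSP computation are correct. -/
theorem apspSpec_coreAt (hI : G.IsIdSets ids) {t v : ℕ} (hv : v ∈ G.verts)
    (ht : (ids v).card + G.lev v ≤ t) :
    G.APSPSpec v ⟨(G.coreAt ids t v).dist, (G.coreAt ids t v).count,
      (G.coreAt ids t v).preds⟩ := by
  intro x hx
  by_cases hxi : x ∈ ids v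
  · have h : place (ids v) x + G.lev v ≤ t := by have := place_le_card (ids v) x; omega
    exact ⟨coreAt_dist hv hxi h, coreAt_count hv hxi h, coreAt_preds hv hxi h⟩
  · have hd : G.dist x v = ⊤ := by
      by_contra h
      exact hxi (hI.mem_of_dist_ne_top hx h)
    have hd' := coreAt_dist_of_notMem (t := t) hI hv hxi
    have hp : (G.coreAt ids t v).preds x = ∅ := by
      rw [Core.preds, if_pos (Or.inr hd')]
    refine ⟨hd'.trans hd.symm, ?_, ?_⟩
    · have hxv : x ≠ v := fun h => hxi (h ▸ hI.self_mem v hv)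
      change Core.count _ _ = _
      rw [Core.count, if_neg (by simpa using hxv), hp,
        Finset.sum_empty, numSP_eq_zero hd]
    · refine hp.trans ?_
      ext u
      simp [mem_preds, hd]

end WDag

namespace WDag

variable {G : WDag} {ids : ℕ → Finset ℕ}

theorem IsIdSets.card_pos (hI : G.IsIdSets ids) {v : ℕ} (hv : v ∈ G.verts) :
    0 < (ids v).card :=
  Finset.card_pos.2 ⟨v, hI.self_mem v hv⟩

theorem IsIdSets.card_le (hI : G.IsIdSets ids) {v : ℕ} (hv : v ∈ G.verts) :
    (ids v).card ≤ G.n :=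
  Finset.card_le_card (hI.subset v hv)

/-! ## APSP without termination -/

theorem isRun_dagAPSP (hI : G.IsIdSets ids) :
    dagAPSP.IsRun G (fun v => Core.start (G.view v) (ids v)) (G.coreAt ids) where
  zero := fun v _ => coreAt_zero v
  succ := fun t v _ => by
    refine (coreAt_succ hI (fun u e => ?_) fun u e => ?_).symm
    · exact if_pos (Or.inl e)
    · have : (if G.Linked u v then dagAPSP.send (G.coreAt ids t u) v else none) = none := by
        split_ifs
        · exact coreAt_send_of_not_edge e
        · rfl
      simp [this]

theorem coreAt_output_isSome (t v : ℕ) : (G.coreAt ids t v).output.isSome ↔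
    (ids v).card + G.lev v + (if (G.view v).outs = ∅ then 0 else 1) ≤ t := by
  rw [Core.output, coreAt_level?]
  by_cases h : G.lev v ≤ t
  · simp only [if_pos h, coreAt_view, coreAt_ids, coreAt_clock]
    by_cases he : (G.view v).outs = ∅
    · simp only [he, if_true]
      split_ifs with h' <;> simp only [Option.isSome_some, Option.isSome_none,
        Bool.false_eq_true, h']
    · simp only [he, if_false]
      split_ifs with h' <;> simp only [Option.isSome_some, Option.isSome_none,
        Bool.false_eq_true, h']
  · simp only [if_neg h]
    refine iff_of_false (by simp) fun h' => h ?_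
    omega

theorem coreAt_output_eq {t v : ℕ} {o : Core.Output} (h : (G.coreAt ids t v).output = some o) :
    (ids v).card + G.lev v ≤ t ∧
      o = ⟨(G.coreAt ids t v).dist, (G.coreAt ids t v).count, (G.coreAt ids t v).preds⟩ := by
  constructor
  · have := (coreAt_output_isSome t v).1 (by rw [h]; rfl)
    omega
  · rw [Core.output] at h
    split at h
    · simp at h
    · split_ifs at h <;> exact (Option.some.inj h).symm

/-- The inequality is strict because the source of largest rank is sent at time `card + lev` itself.
This is the extra round before termination of nodes with outgoing edges. -/
theorem coreAt_send_eq_none {t v : ℕ} (w : ℕ) (ht : (ids v).card + G.lev v < t) :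
    (G.coreAt ids t v).send w = none := by
  rcases hs : (G.coreAt ids t v).send w with _ | μ
  · rfl
  · obtain ⟨e, ⟨l, rfl⟩ | ⟨x, d, c, rfl⟩⟩ := coreAt_send_kind hs
    · rw [coreAt_send_level e] at hs
      omega
    · rw [coreAt_send_sssp e] at hs
      have := place_le_card (ids v) x
      omega

theorem quiet_dagAPSP : dagAPSP.Quiet G (G.coreAt ids) := by
  intro t v h t' ht w hw
  change (G.coreAt ids t' v).send w = none
  replace h : (G.coreAt ids t v).output.isSome := h
  rw [coreAt_output_isSome] at h
  by_cases e : (v, w) ∈ G.edges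
  · rw [if_neg (fun hc => by simpa [hc] using G.mem_outs.2 e)] at h
    exact coreAt_send_eq_none w (by omega)
  · exact coreAt_send_of_not_edge e

/-- One level message, and one message per source other than the head `v`, which cannot reach the
tail `u`. -/
theorem card_coreAt_send_le (hI : G.IsIdSets ids) (T : ℕ) {u v : ℕ} (e : (u, v) ∈ G.edges) :
    {t ∈ Finset.range T | ((G.coreAt ids t u).send v).isSome}.card ≤ (ids u).card := by
  have hv : v ∈ ids u := by
    rw [hI.edge u v e]
    exact hI.self_mem v (G.edges_mem _ e).2
  have hsub : {t ∈ Finset.range T | ((G.coreAt ids t u).send v).isSome} ⊆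
      insert (G.lev u) (((ids u).erase v).image fun x => place (ids u) x + G.lev u) := by
    intro t ht
    obtain ⟨μ, hμ⟩ := Option.isSome_iff_exists.1 (Finset.mem_filter.1 ht).2
    obtain ⟨-, ⟨l, rfl⟩ | ⟨x, d, c, rfl⟩⟩ := coreAt_send_kind hμ
    · rw [coreAt_send_level e] at hμ
      exact Finset.mem_insert.2 (Or.inl hμ.1)
    · rw [coreAt_send_sssp e] at hμ
      refine Finset.mem_insert_of_mem (Finset.mem_image.2 ⟨x, ?_, hμ.2.1⟩)
      refine Finset.mem_erase.2 ⟨?_, hμ.1⟩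
      rintro rfl
      exact hμ.2.2.1 (dist_eq_top_of_edge e)
  calc _ ≤ _ := Finset.card_le_card hsub
    _ ≤ _ := Finset.card_insert_le _ _
    _ ≤ ((ids u).erase v).card + 1 := Nat.add_le_add_right Finset.card_image_le 1
    _ = (ids u).card := Finset.card_erase_add_one hv

/-! ## Betweenness centrality without termination -/

open Classical in
/-- The state of a node at time `t` in the computation of the betweenness centrality without
termination. -/
noncomputable def bcAt (G : WDag) (ids : ℕ → Finset ℕ) (t v : ℕ) : BCState where
  core := G.coreAt ids t v
  succTop := fun w => if (v, w) ∈ G.edges ∧ G.topTime w < t then some (G.topLev w) else none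
  topSent := decide (G.topTime v < t)
  -- The share of `w` is present once its sending time 2(card + `topLev w`) - (place + `lev w`) is
  -- past; the subtraction is moved to the other side.
  dep := fun x => ∑ w ∈ G.succs x v,
    if 2 * ((ids v).card + G.topLev w) < t + (place (ids v) x + G.lev w) then
      (G.numSP x v : ℚ) * ((1 + G.dependency x w) / G.numSP x w)
    else 0

@[simp] theorem bcAt_core (t v : ℕ) : (G.bcAt ids t v).core = G.coreAt ids t v := rfl

/-- From `topLev w ≤ topLev v` and `lev v < lev w`, each successor `w` sends strictly before the
time at which `v` is due. -/
theorem bcAt_dep {t v x : ℕ}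
    (ht : 2 * ((ids v).card + G.topLev v) ≤ t + (place (ids v) x + G.lev v)) :
    (G.bcAt ids t v).dep x = G.dependency x v := by
  rw [dependency_eq_sum]
  refine Finset.sum_congr rfl fun w hw => if_pos ?_
  have e := (mem_preds.1 (mem_succs.1 hw)).1
  have := topLev_le e
  have := G.lev_lt e
  omega

theorem bcAt_zero (hI : G.IsIdSets ids) (v : ℕ) :
    G.bcAt ids 0 v = BCState.start (G.view v) (ids v) := by
  have h : (G.bcAt ids 0 v).dep = fun _ => 0 := by
    funext x
    refine Finset.sum_eq_zero fun w hw => if_neg ?_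
    have e := (mem_preds.1 (mem_succs.1 hw)).1
    have := hI.card_pos (G.edges_mem _ e).1
    have := place_le_card (ids v) x
    have := G.lev_le_topLev w
    omega
  calc G.bcAt ids 0 v = ⟨G.coreAt ids 0 v, (G.bcAt ids 0 v).succTop, (G.bcAt ids 0 v).topSent,
        (G.bcAt ids 0 v).dep⟩ := rfl
    _ = BCState.start (G.view v) (ids v) := by
      rw [h, coreAt_zero]
      simp [BCState.start, bcAt]

theorem bcAt_top? (t v : ℕ) :
    (G.bcAt ids t v).top? = if G.topTime v ≤ t then some (G.topLev v) else none := by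
  rw [BCState.top?, bcAt_core, coreAt_level?, coreAt_view]
  by_cases hl : G.lev v ≤ t
  · rw [if_pos hl]
    have h : (∀ w ∈ (G.view v).outs, ((G.bcAt ids t v).succTop w).isSome) ↔
        G.topTime v ≤ t := by
      rw [topTime_eq, max_le_iff, Finset.sup_le_iff, and_iff_right hl]
      refine forall₂_congr fun w hw => ?_
      rw [mem_outs] at hw
      simp [bcAt, hw]
    simp only [h]
    split_ifs with ht
    · rw [topLev_eq]
      congr 2
      refine Finset.sup_congr rfl fun w hw => ?_
      have h' := h.2 ht w hw
      rw [mem_outs] at hw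
      simp only [bcAt] at h' ⊢
      split_ifs at h' ⊢
      · rfl
      · simp at h'
    · rfl
  · rw [if_neg hl, if_neg fun h => hl ((lev_le_topTime v).trans h)]

theorem bcAt_send_of_edge {t u v : ℕ} (e : (u, v) ∈ G.edges) :
    (G.bcAt ids t u).send v = (G.coreAt ids t u).send v :=
  if_pos (show v ∈ (G.view u).outs from G.mem_outs.2 e)

theorem bcAt_send_of_not_linked {t u v : ℕ} (h : ¬ G.Linked u v) :
    (G.bcAt ids t u).send v = none := by
  rw [BCState.send, if_neg, if_neg]
  · simpa using fun e => h (Or.inr e)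
  · simpa using fun e => h (Or.inl e)

theorem bcAt_send_cases {t v w : ℕ} (e : (v, w) ∈ G.edges) :
    (G.bcAt ids t w).send v =
      if t = G.topTime w then some (.top (G.topLev w)) else
      match pick {x ∈ ids w | t + (place (ids w) x + G.lev w) =
        2 * ((ids w).card + G.topLev w)} with
      | none => none
      | some x => if v ∈ G.preds x w then
          some (.acc x ((1 + G.dependency x w) / G.numSP x w)) else none := by
  have hw := (G.edges_mem _ e).2
  have h1 : v ∉ (G.bcAt ids t w).core.view.outs := by simpa using G.not_edge_symm e
  have h2 : v ∈ (G.bcAt ids t w).core.view.ins := by simpa using e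
  have h3 := G.topTime_add_lev_le w
  have h4 := G.lev_le_topTime w
  rw [BCState.send, if_neg h1, if_pos h2, bcAt_core, coreAt_level?, bcAt_top?]
  have hF : ({x ∈ (G.coreAt ids t w).ids | (G.coreAt ids t w).clock +
      ((G.coreAt ids t w).newId x + G.lev w) =
      (G.bcAt ids t w).termRound (G.topLev w) + (G.bcAt ids t w).termRound (G.topLev w)} :
        Finset ℕ) =
      {x ∈ ids w | t + (place (ids w) x + G.lev w) = 2 * ((ids w).card + G.topLev w)} := by
    refine Finset.filter_congr fun x _ => ?_
    rw [two_mul]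
    rfl
  rcases lt_trichotomy t (G.topTime w) with h | h | h
  · rw [if_neg h.not_ge, if_neg h.ne]
    -- Nothing is due before `topTime`, by `topTime_add_lev_le` and because ranks are at most the
    -- cardinality.
    have : pick {x ∈ ids w | t + (place (ids w) x + G.lev w) =
        2 * ((ids w).card + G.topLev w)} = none := by
      rw [pick_eq_none, Finset.filter_eq_empty_iff]
      intro x _
      have := place_le_card (ids w) x
      omega
    rw [this]
    split <;> simp_all
  · rw [if_pos h.ge, if_pos h, if_pos (h4.trans h.ge)]
    simp [bcAt, h]
  · rw [if_pos h.le, if_neg h.ne', if_pos (h4.trans h.le)]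
    have h5 : (G.bcAt ids t w).topSent = true := by simp [bcAt, h]
    simp only [h5, Bool.true_eq_false, if_false, hF]
    rcases hp : pick {x ∈ ids w | t + (place (ids w) x + G.lev w) =
        2 * ((ids w).card + G.topLev w)} with _ | x
    · rfl
    · obtain ⟨hx, hxt⟩ := Finset.mem_filter.1 (mem_of_pick hp)
      -- The APSP time is at most card + `topLev`, so its reflection 2(card + `topLev`) - (place +
      -- lev) is no earlier: the values for `x` are final.
      have hxl : place (ids w) x + G.lev w ≤ t := by
        have := place_le_card (ids w) x
        have := G.lev_le_topLev w
        omega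
      simp only [coreAt_preds hw hx hxl, coreAt_count hw hx hxl, bcAt_dep hxt.ge]

theorem bcAt_send_kind {t v w : ℕ} {μ : Msg} (e : (v, w) ∈ G.edges)
    (h : (G.bcAt ids t w).send v = some μ) :
    (∃ M, μ = .top M) ∨ ∃ x q, μ = .acc x q := by
  rw [bcAt_send_cases e] at h
  split_ifs at h with h1
  · exact Or.inl ⟨_, (Option.some.inj h).symm⟩
  · split at h
    · simp at h
    · split_ifs at h
      exact Or.inr ⟨_, _, (Option.some.inj h).symm⟩

theorem bcAt_send_top {t v w M : ℕ} (e : (v, w) ∈ G.edges) :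
    (G.bcAt ids t w).send v = some (.top M) ↔ t = G.topTime w ∧ M = G.topLev w := by
  rw [bcAt_send_cases e]
  split_ifs with h
  · simp [h, eq_comm]
  · simp only [h, false_and, iff_false]
    split
    · simp
    · split_ifs <;> simp

theorem bcAt_send_acc {t v w x : ℕ} {q : ℚ} (e : (v, w) ∈ G.edges) :
    (G.bcAt ids t w).send v = some (.acc x q) ↔ x ∈ ids w ∧
      t + (place (ids w) x + G.lev w) = 2 * ((ids w).card + G.topLev w) ∧ v ∈ G.preds x w ∧
        q = (1 + G.dependency x w) / G.numSP x w := by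
  rw [bcAt_send_cases e]
  split_ifs with h
  · simp only [Option.some.injEq, reduceCtorEq, false_iff]
    rintro ⟨hx, hxt, -⟩
    have := place_pos hx
    have := place_le_card (ids w) x
    have := G.topTime_add_lev_le w
    omega
  · constructor
    · intro hs
      rcases hp : pick {x ∈ ids w | t + (place (ids w) x + G.lev w) =
        2 * ((ids w).card + G.topLev w)} with _ | y
      · simp [hp] at hs
      · obtain ⟨hx, hxt⟩ := Finset.mem_filter.1 (mem_of_pick hp)
        simp only [hp] at hs
        split_ifs at hs with hd
        simp only [Option.some.injEq, Msg.acc.injEq] at hs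
        obtain ⟨rfl, rfl⟩ := hs
        exact ⟨hx, hxt, hd, rfl⟩
    · rintro ⟨hx, hxt, hd, rfl⟩
      have : pick {x ∈ ids w | t + (place (ids w) x + G.lev w) =
          2 * ((ids w).card + G.topLev w)} = some x := by
        refine pick_eq_some (Finset.mem_filter.2 ⟨hx, hxt⟩) fun y hy => ?_
        obtain ⟨hy, hyt⟩ := Finset.mem_filter.1 hy
        exact place_injOn (ids w) hy hx (by omega)
      rw [this]
      simp [hd]

theorem accGain_eq_zero {c x : ℕ} {m : Option Msg} (h : ∀ q, m ≠ some (.acc x q)) :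
    BCState.accGain c x m = 0 := by
  unfold BCState.accGain
  split
  · split_ifs with hx
    · exact (h _ (by rw [hx])).elim
    · rfl
  · rfl

theorem bcAt_succ (hI : G.IsIdSets ids) {t v : ℕ} {inbox : ℕ → Option Msg}
    (hin : ∀ u, inbox u = (G.bcAt ids t u).send v) :
    (G.bcAt ids t v).recv inbox = G.bcAt ids (t + 1) v := by
  have hC : (G.coreAt ids t v).recv inbox = G.coreAt ids (t + 1) v := by
    refine coreAt_succ hI (fun u e => ?_) fun u e => ?_
    · rw [hin, bcAt_send_of_edge e]
    · rw [hin]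
      by_cases e' : (v, u) ∈ G.edges
      · constructor
        · intro l hl
          rcases bcAt_send_kind e' hl with ⟨_, h⟩ | ⟨_, _, h⟩ <;> simp at h
        · intro x d c hl
          rcases bcAt_send_kind e' hl with ⟨_, h⟩ | ⟨_, _, h⟩ <;> simp at h
      · rw [bcAt_send_of_not_linked (by rintro (h | h); exacts [e h, e' h])]
        simp
  have hT : ((G.bcAt ids t v).recv inbox).succTop = (G.bcAt ids (t + 1) v).succTop := by
    funext w
    simp only [BCState.recv, hin]
    by_cases e : (v, w) ∈ G.edges
    · split
      · rename_i M hM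
        rw [bcAt_send_top e] at hM
        simp [bcAt, e, hM]
      · rename_i hM
        have hne : t ≠ G.topTime w := fun ht => hM _ (by
          rw [bcAt_send_top e]; exact ⟨ht, rfl⟩)
        have hiff : G.topTime w < t + 1 ↔ G.topTime w < t := by omega
        simp only [bcAt, hiff]
    · split
      · rename_i M hM
        by_cases e' : (w, v) ∈ G.edges
        · rw [bcAt_send_of_edge e'] at hM
          obtain ⟨-, ⟨_, h⟩ | ⟨_, _, _, h⟩⟩ := coreAt_send_kind hM <;> simp at h
        · rw [bcAt_send_of_not_linked (by rintro (h | h); exacts [e' h, e h])] at hM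
          simp at hM
      · simp [bcAt, e]
  have hS : ((G.bcAt ids t v).recv inbox).topSent = (G.bcAt ids (t + 1) v).topSent := by
    simp only [BCState.recv, bcAt_top?]
    by_cases h : G.topTime v ≤ t
    · simp [h, bcAt]
    · simp [h, bcAt]
  have hD : ((G.bcAt ids t v).recv inbox).dep = (G.bcAt ids (t + 1) v).dep := by
    funext x
    simp only [BCState.recv, bcAt_core, coreAt_view]
    -- Only successors for `x` send accumulation values for `x`.
    have h1 : ∑ w ∈ (G.view v).outs,
        BCState.accGain ((G.coreAt ids t v).count x) x (inbox w) =
        ∑ w ∈ G.succs x v, BCState.accGain ((G.coreAt ids t v).count x) x (inbox w) := by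
      refine (Finset.sum_subset (Finset.filter_subset _ _) fun w hw hw' => ?_).symm
      have e := G.mem_outs.1 hw
      refine accGain_eq_zero fun q hq => hw' ?_
      rw [hin, bcAt_send_acc e] at hq
      exact mem_succs.2 hq.2.2.1
    rw [h1]
    simp only [bcAt]
    rw [← Finset.sum_add_distrib]
    refine Finset.sum_congr rfl fun w hw => ?_
    have hp := mem_succs.1 hw
    have hp' := mem_preds.1 hp
    have e := hp'.1
    have hv := (G.edges_mem _ e).1
    have hids := hI.edge v w e
    have hx : x ∈ ids v := by
      obtain ⟨p, hp⟩ := exists_path_of_dist_ne_top hp'.2.1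
      rw [hids]
      exact hI.mem_of_dist_ne_top (hp.1 x (List.mem_of_head? hp.2.2.1)) hp'.2.1
    -- The guard in `dep` switches on for `w` in exactly the round in which its value arrives.
    by_cases ht : t + (place (ids v) x + G.lev w) = 2 * ((ids v).card + G.topLev w)
    · have hq : inbox w = some (.acc x ((1 + G.dependency x w) / G.numSP x w)) := by
        rw [hin, bcAt_send_acc e, ← hids]
        exact ⟨hx, ht, hp, rfl⟩
      have hxl : place (ids v) x + G.lev v ≤ t := by
        have := place_le_card (ids v) x
        have := G.lev_le_topLev w
        have := G.lev_lt e
        omega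
      rw [hq, if_neg (by omega), if_pos (by omega), coreAt_count hv hx hxl]
      simp [BCState.accGain]
    · rw [accGain_eq_zero, add_zero]
      · have hiff : 2 * ((ids v).card + G.topLev w) < t + 1 + (place (ids v) x + G.lev w) ↔
            2 * ((ids v).card + G.topLev w) < t + (place (ids v) x + G.lev w) := by omega
        simp only [hiff]
      · intro q hq
        rw [hin, bcAt_send_acc e, ← hids] at hq
        exact ht hq.2.1
  calc (G.bcAt ids t v).recv inbox = ⟨(G.coreAt ids t v).recv inbox,
        ((G.bcAt ids t v).recv inbox).succTop, ((G.bcAt ids t v).recv inbox).topSent,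
        ((G.bcAt ids t v).recv inbox).dep⟩ := rfl
    _ = G.bcAt ids (t + 1) v := by rw [hC, hT, hS, hD]; rfl

theorem isRun_dagBC (hI : G.IsIdSets ids) :
    dagBC.IsRun G (fun v => BCState.start (G.view v) (ids v)) (G.bcAt ids) where
  zero := fun v _ => bcAt_zero hI v
  succ := fun t v _ => by
    refine (bcAt_succ hI fun u => ?_).symm
    split_ifs with h
    · rfl
    · exact (bcAt_send_of_not_linked h).symm

theorem bcAt_output (t v : ℕ) : (G.bcAt ids t v).output =
    if 2 * ((ids v).card + G.topLev v) ≤ t + G.lev v then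
      some (∑ x ∈ (ids v).erase v, (G.bcAt ids t v).dep x) else none := by
  have h1 := G.topTime_add_lev_le v
  have h2 := G.lev_le_topTime v
  rw [BCState.output, bcAt_core, coreAt_level?, bcAt_top?]
  by_cases h : G.topTime v ≤ t
  · rw [if_pos h, if_pos (h2.trans h), two_mul]
    rfl
  -- Before `topTime` the termination inequality cannot hold, again by `topTime_add_lev_le`.
  · rw [if_neg h, if_neg (show ¬ 2 * ((ids v).card + G.topLev v) ≤ t + G.lev v by omega)]
    split
    · simp_all
    · rfl

theorem bcAt_output_isSome {t v : ℕ} : (G.bcAt ids t v).output.isSome ↔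
    2 * ((ids v).card + G.topLev v) ≤ t + G.lev v := by
  rw [bcAt_output]
  split_ifs with h <;> simp [h]

theorem bcSpec_bcAt (hI : G.IsIdSets ids) {t v : ℕ} {o : ℚ} (hv : v ∈ G.verts)
    (h : (G.bcAt ids t v).output = some o) : G.BCSpec v o := by
  have ht := bcAt_output_isSome.1 (by rw [h]; rfl)
  rw [bcAt_output, if_pos ht, Option.some.injEq] at h
  rw [BCSpec, bc_eq_sum, ← h, Finset.sum_congr rfl fun x hx => bcAt_dep (by omega)]
  refine Finset.sum_subset (Finset.erase_subset_erase _ (hI.subset v hv)) fun x hx hx' => ?_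
  rw [Finset.mem_erase] at hx hx'
  refine dependency_eq_zero ?_
  by_contra hd
  exact hx' ⟨hx.1, hI.mem_of_dist_ne_top hx.2 hd⟩

/-- At time 2(card + `topLev`) - `lev` the distances and the `top` value have long been sent, and
the accumulation is over because the smallest rank is 1. -/
theorem quiet_dagBC (hI : G.IsIdSets ids) : dagBC.Quiet G (G.bcAt ids) := by
  intro t v h t' ht w hw
  replace h : (G.bcAt ids t v).output.isSome := h
  rw [bcAt_output_isSome] at h
  change (G.bcAt ids t' v).send w = none
  have hc := hI.card_pos (Linked.mem_left hw)
  have h0 := G.lev_le_topLev v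
  rcases hw with e | e
  · rw [bcAt_send_of_edge e]
    exact coreAt_send_eq_none w (by omega)
  · rcases hs : (G.bcAt ids t' v).send w with _ | μ
    · rfl
    · rcases bcAt_send_kind e hs with ⟨M, rfl⟩ | ⟨x, q, rfl⟩
      · rw [bcAt_send_top e] at hs
        have := G.topTime_add_lev_le v
        omega
      · rw [bcAt_send_acc e] at hs
        have := place_pos hs.1
        omega

/-- One `top` message, and one value per source other than `v`, which has no predecessors for
itself. -/
theorem card_bcAt_send_le (hI : G.IsIdSets ids) (T : ℕ) {u v : ℕ} (e : (u, v) ∈ G.edges) :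
    {t ∈ Finset.range T | ((G.bcAt ids t v).send u).isSome}.card ≤ (ids v).card := by
  have hv := hI.self_mem v (G.edges_mem _ e).2
  have hsub : {t ∈ Finset.range T | ((G.bcAt ids t v).send u).isSome} ⊆
      insert (G.topTime v) (((ids v).erase v).image fun x =>
        2 * ((ids v).card + G.topLev v) - (place (ids v) x + G.lev v)) := by
    intro t ht
    obtain ⟨μ, hμ⟩ := Option.isSome_iff_exists.1 (Finset.mem_filter.1 ht).2
    rcases bcAt_send_kind e hμ with ⟨M, rfl⟩ | ⟨x, q, rfl⟩
    · rw [bcAt_send_top e] at hμ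
      exact Finset.mem_insert.2 (Or.inl hμ.1)
    · rw [bcAt_send_acc e] at hμ
      refine Finset.mem_insert_of_mem (Finset.mem_image.2 ⟨x, ?_, by omega⟩)
      refine Finset.mem_erase.2 ⟨?_, hμ.1⟩
      rintro rfl
      have := hμ.2.2.1
      rw [preds_self] at this
      exact Finset.notMem_empty _ this
  calc _ ≤ _ := Finset.card_le_card hsub
    _ ≤ _ := Finset.card_insert_le _ _
    _ ≤ ((ids v).erase v).card + 1 := Nat.add_le_add_right Finset.card_image_le 1
    _ = (ids v).card := Finset.card_erase_add_one hv

/-! ## Message lengths -/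

theorem n_size_pos {v : ℕ} (hv : v ∈ G.verts) : 0 < G.n.size :=
  Nat.size_pos.2 (Finset.card_pos.2 ⟨v, hv⟩)

theorem size_le_apspB {x y : ℕ} (hx : x ∈ G.verts) (hy : y ∈ G.verts) :
    G.n.size + ((G.dist x y).toNat.size + (G.numSP x y).size) ≤ G.apspB :=
  Nat.add_le_add_left (Finset.le_sup
    (f := fun e : ℕ × ℕ => (G.dist e.1 e.2).toNat.size + (G.numSP e.1 e.2).size)
    (Finset.mk_mem_product hx hy)) _

theorem n_size_le_apspB : G.n.size ≤ G.apspB := Nat.le_add_right _ _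

theorem apspB_le_bcB : G.apspB ≤ G.bcB := Nat.le_add_right _ _

theorem ratBits_le_bcB {x y : ℕ} (hx : x ∈ G.verts) (hy : y ∈ G.verts) :
    ratBits ((1 + G.dependency x y) / (G.numSP x y : ℚ)) ≤ G.bcB :=
  (Finset.le_sup
    (f := fun e : ℕ × ℕ => ratBits ((1 + G.dependency e.1 e.2) / (G.numSP e.1 e.2 : ℚ)))
    (Finset.mk_mem_product hx hy)).trans (Nat.le_add_left _ _)

theorem coreAt_bits_le (hI : G.IsIdSets ids) {s t u v : ℕ} {μ : Msg}
    (hs : ∀ x ∈ G.verts, x.size ≤ s) (h : (G.coreAt ids t u).send v = some μ) :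
    μ.bits ≤ 3 + s + G.apspB := by
  obtain ⟨e, ⟨l, rfl⟩ | ⟨x, d, c, rfl⟩⟩ := coreAt_send_kind h
  · rw [coreAt_send_level e] at h
    have hu : u ∈ G.verts := (G.edges_mem _ e).1
    have h1 : l ≤ G.n := by
      have := longest_lt_n ⟨u, hu⟩
      have := lev_le_longest hu
      omega
    have := Nat.size_le_size h1
    have := G.n_size_le_apspB
    simp only [Msg.bits]
    omega
  · rw [coreAt_send_sssp e] at h
    obtain ⟨hx, -, -, rfl, rfl⟩ := h
    have hu : u ∈ G.verts := (G.edges_mem _ e).1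
    have hx' := hI.subset u hu hx
    have := hs x hx'
    have := size_le_apspB hx' hu
    simp only [Msg.bits]
    omega

theorem bcAt_bits_le (hI : G.IsIdSets ids) {s t u v : ℕ} {μ : Msg}
    (hs : ∀ x ∈ G.verts, x.size ≤ s) (huv : G.Linked u v)
    (h : (G.bcAt ids t u).send v = some μ) :
    μ.bits ≤ 3 + s + G.bcB := by
  rcases huv with e | e
  · rw [bcAt_send_of_edge e] at h
    exact (coreAt_bits_le hI hs h).trans (Nat.add_le_add_left apspB_le_bcB _)
  · have hu : u ∈ G.verts := (G.edges_mem _ e).2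
    rcases bcAt_send_kind e h with ⟨M, rfl⟩ | ⟨x, q, rfl⟩
    · rw [bcAt_send_top e] at h
      have h1 : M ≤ G.n := by
        have := longest_lt_n ⟨u, hu⟩
        have := topLev_le_longest hu
        omega
      have := Nat.size_le_size h1
      have := G.n_size_le_apspB
      have := G.apspB_le_bcB
      simp only [Msg.bits]
      omega
    · rw [bcAt_send_acc e] at h
      obtain ⟨hx, -, -, rfl⟩ := h
      have hx' := hI.subset u hu hx
      have := hs x hx'
      have := ratBits_le_bcB hx' hu
      simp only [Msg.bits]
      omega

/-! ## The algorithms for known `n` -/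

theorem isIdSets_Icc (h : G.verts = Finset.Icc 1 G.n) :
    G.IsIdSets fun _ => Finset.Icc 1 G.n where
  self_mem := fun _ hv => h ▸ hv
  subset := fun _ _ => h.ge
  edge := fun _ _ _ => rfl

theorem size_le_of_verts_eq (h : G.verts = Finset.Icc 1 G.n) :
    ∀ x ∈ G.verts, x.size ≤ G.n.size := by
  intro x hx
  rw [h, Finset.mem_Icc] at hx
  exact Nat.size_le_size hx.2

theorem computes_dagAPSP (h : G.verts = Finset.Icc 1 G.n) :
    dagAPSP.Computes Msg.bits G (fun v => (G.n, G.view v)) G.APSPSpec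
      (G.n + G.longest) (G.m * G.n) (5 * G.apspB) := by
  have hI := isIdSets_Icc h
  have hF := isRun_dagAPSP hI
  have hc : (Finset.Icc 1 G.n).card = G.n := by simp
  refine DistAlg.computes_of_isRun hF quiet_dagAPSP le_rfl (fun v hv => ?_)
    (fun v hv t o ho => ?_) ?_ (fun t u v μ huv hμ => ?_)
  · refine (coreAt_output_isSome _ v).2 ?_
    rw [hc]
    split_ifs with he
    · have := lev_le_longest hv
      omega
    -- A node with an outgoing edge lies strictly below the longest length, which absorbs its extra
    -- round.
    · obtain ⟨w, hw⟩ := Finset.nonempty_iff_ne_empty.2 he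
      have := lev_lt_longest (G.mem_outs.1 hw)
      omega
  · obtain ⟨ht, rfl⟩ := coreAt_output_eq ho
    exact apspSpec_coreAt hI hv ht
  · refine (DistAlg.messages_le hF quiet_dagAPSP (a := G.n) (b := 0) (fun u v e => ?_)
      fun u v e => ?_).trans_eq (by rw [add_zero])
    · exact (card_coreAt_send_le hI _ e).trans_eq hc
    · refine (Finset.card_eq_zero.2 (Finset.filter_eq_empty_iff.2 fun t _ => ?_)).le
      have : dagAPSP.send (G.coreAt (fun _ => Finset.Icc 1 G.n) t v) u = none :=
        coreAt_send_of_not_edge (G.not_edge_symm e)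
      simp [this]
  -- The length 3 + log n + B is at most 5B since B ≥ 1.
  · have := coreAt_bits_le hI (size_le_of_verts_eq h) hμ
    have := n_size_pos (Linked.mem_left huv)
    have := G.n_size_le_apspB
    omega

theorem computes_dagBC (h : G.verts = Finset.Icc 1 G.n) :
    dagBC.Computes Msg.bits G (fun v => (G.n, G.view v)) G.BCSpec
      (2 * G.n + 2 * G.longest) (G.m * (G.n + G.n)) (5 * G.bcB) := by
  have hI := isIdSets_Icc h
  have hF := isRun_dagBC hI
  have hQ := quiet_dagBC hI
  have hc : (Finset.Icc 1 G.n).card = G.n := by simp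
  refine DistAlg.computes_of_isRun hF hQ le_rfl (fun v hv => ?_)
    (fun _ hv _ _ ho => bcSpec_bcAt hI hv ho) ?_ (fun t u v μ huv hμ => ?_)
  · refine bcAt_output_isSome.2 ?_
    rw [hc]
    have := topLev_le_longest hv
    omega
  · refine DistAlg.messages_le hF hQ (fun u v e => ?_) fun u v e => ?_
    · refine le_trans (le_of_eq ?_) ((card_coreAt_send_le hI
        (2 * G.n + 2 * G.longest) e).trans_eq hc)
      congr 2
      funext t
      exact congrArg (fun m : Option Msg => m.isSome = true) (bcAt_send_of_edge e)
    · exact (card_bcAt_send_le hI _ e).trans_eq hc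
  · have := bcAt_bits_le hI (size_le_of_verts_eq h) huv hμ
    have := n_size_pos (Linked.mem_left huv)
    have := G.n_size_le_apspB
    have := G.apspB_le_bcB
    omega

end WDag

/-! # Spreading the IDs -/

namespace WDag

variable (G : WDag)

/-- The communication network. -/
def net : SimpleGraph ℕ where
  Adj := G.Linked
  symm := ⟨fun _ _ h => h.symm⟩
  loopless := ⟨fun v h => h.elim (G.not_edge_self v) (G.not_edge_self v)⟩

/-- The undirected hop distance. -/
noncomputable def hop (u v : ℕ) : ℕ := G.net.dist u v

open Classical in
/-- The nodes of the connected component of `v`. -/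
noncomputable def comp (v : ℕ) : Finset ℕ := {x ∈ G.verts | G.net.Reachable v x}

variable {G}

theorem mem_comp {v x : ℕ} : x ∈ G.comp v ↔ x ∈ G.verts ∧ G.net.Reachable v x := by
  simp [comp]

theorem Linked.adj {u v : ℕ} (h : G.Linked u v) : G.net.Adj u v := h

theorem Linked.comp_eq {u v : ℕ} (h : G.Linked u v) : G.comp u = G.comp v := by
  ext x
  rw [mem_comp, mem_comp]
  have h' : G.net.Reachable u v := SimpleGraph.Adj.reachable h
  exact and_congr_right fun _ => ⟨fun hx => h'.symm.trans hx, fun hx => h'.trans hx⟩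

theorem isIdSets_comp : G.IsIdSets G.comp where
  self_mem := fun v hv => mem_comp.2 ⟨hv, SimpleGraph.Reachable.refl v⟩
  subset := fun _ _ _ hx => (mem_comp.1 hx).1
  edge := fun _ _ e => Linked.comp_eq (Or.inl e)

theorem hop_self (v : ℕ) : G.hop v v = 0 := SimpleGraph.dist_self

/-- Membership in the component matters: `SimpleGraph.dist` is 0 for unreachable pairs. -/
theorem hop_le {u v s : ℕ} (h : G.Linked u v) (hs : s ∈ G.comp u) :
    G.hop v s ≤ G.hop u s + 1 := by
  obtain ⟨p, hp⟩ := (mem_comp.1 hs).2.exists_walk_length_eq_dist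
  rw [hop, hop, ← hp]
  exact SimpleGraph.dist_le (SimpleGraph.Walk.cons (Linked.adj h).symm p)

theorem eq_of_hop_eq_zero {v s : ℕ} (hs : s ∈ G.comp v) (h : G.hop v s = 0) : s = v :=
  ((mem_comp.1 hs).2.dist_eq_zero_iff.1 h).symm

theorem exists_linked_hop {v s d : ℕ} (hs : s ∈ G.comp v) (h : G.hop v s = d + 1) :
    ∃ u, G.Linked u v ∧ s ∈ G.comp u ∧ G.hop u s = d := by
  obtain ⟨p, hp⟩ := (mem_comp.1 hs).2.exists_walk_length_eq_dist
  rw [← hop, h] at hp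
  cases p with
  | nil => simp at hp
  | @cons _ u _ ha p =>
    have huv : G.Linked u v := ha.symm
    have hs' : s ∈ G.comp u := by rwa [huv.comp_eq]
    refine ⟨u, huv, hs', ?_⟩
    have h1 := hop_le huv hs'
    have h2 : G.hop u s ≤ p.length := SimpleGraph.dist_le p
    rw [SimpleGraph.Walk.length_cons] at hp
    omega

theorem exists_hop_eq {v s d : ℕ} (hv : v ∈ G.verts) (hs : s ∈ G.comp v) (h : d ≤ G.hop v s) :
    ∃ z ∈ G.comp v, G.hop v z = d := by
  obtain ⟨k, hk⟩ := Nat.exists_eq_add_of_le h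
  induction k generalizing s with
  | zero => exact ⟨s, hs, hk⟩
  | succ k ih =>
    have hv' : v ∈ G.comp s := mem_comp.2 ⟨hv, (mem_comp.1 hs).2.symm⟩
    have hk' : G.hop s v = d + k + 1 := by
      rw [hop, SimpleGraph.dist_comm]
      exact hk
    obtain ⟨u, hus, hu, hd⟩ := exists_linked_hop hv' hk'
    have hu' : u ∈ G.comp v := mem_comp.2 ⟨Linked.mem_left hus, (mem_comp.1 hu).2.symm⟩
    have hd' : G.hop v u = d + k := by
      rw [hop, SimpleGraph.dist_comm]
      exact hd
    exact ih hu' (by omega) hd'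

/-! ## The final list of a node -/

variable (G) in
/-- The pair of `s` on the final list of `v`. -/
noncomputable def key (v s : ℕ) : ℕ ×ₗ ℕ := toLex (G.hop v s, s)

variable (G) in
/-- The final list of `v`. -/
noncomputable def finalList (v : ℕ) : Finset (ℕ ×ₗ ℕ) := (G.comp v).image (G.key v)

theorem key_injective (v : ℕ) : Function.Injective (G.key v) :=
  fun _ _ h => congrArg (fun p => (ofLex p).2) h

theorem key_mem_finalList {v s : ℕ} (hs : s ∈ G.comp v) : G.key v s ∈ G.finalList v :=
  Finset.mem_image_of_mem _ hs

theorem card_finalList (v : ℕ) : (G.finalList v).card = (G.comp v).card :=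
  Finset.card_image_of_injective _ (key_injective v)

variable (G) in
/-- The position of the pair of `s` on the final list of `v`. -/
noncomputable def spot (v s : ℕ) : ℕ := place (G.finalList v) (G.key v s)

theorem spot_eq (v s : ℕ) : G.spot v s = {z ∈ G.comp v | G.key v z ≤ G.key v s}.card := by
  rw [spot, place, finalList, Finset.filter_image,
    Finset.card_image_of_injective _ (key_injective v)]

theorem key_le_iff {v z s : ℕ} : G.key v z ≤ G.key v s ↔
    G.hop v z < G.hop v s ∨ G.hop v z = G.hop v s ∧ z ≤ s := by
  simp [key, Prod.Lex.toLex_le_toLex]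

/-- Whatever is not after `s` on the list of `u` is not after `s` on that of `v`: distances grow by
at most 1 from `u` to `v`, and for `s` by exactly 1. So distance plus position for `s` is smaller at
`u` than at `v`. -/
theorem spot_le_spot {u v s : ℕ} (h : G.Linked u v) (hs : G.hop v s = G.hop u s + 1) :
    G.spot u s ≤ G.spot v s := by
  rw [spot_eq, spot_eq, ← h.comp_eq]
  refine Finset.card_le_card fun z hz => ?_
  rw [Finset.mem_filter, key_le_iff] at hz ⊢
  refine ⟨hz.1, ?_⟩
  have := hop_le h hz.1
  omega

/-- Each of the distances 0, …, `hop v s` occurs at or before the pair of `s`. -/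
theorem hop_lt_spot {v s : ℕ} (hv : v ∈ G.verts) (hs : s ∈ G.comp v) :
    G.hop v s < G.spot v s := by
  have h : Finset.range (G.hop v s + 1) ⊆
      {z ∈ G.comp v | G.key v z ≤ G.key v s}.image (G.hop v) := by
    intro d hd
    rw [Finset.mem_range] at hd
    rcases Nat.lt_succ_iff_lt_or_eq.1 hd with hd | rfl
    · obtain ⟨z, hz, rfl⟩ := exists_hop_eq hv hs hd.le
      exact Finset.mem_image_of_mem _
        (Finset.mem_filter.2 ⟨hz, key_le_iff.2 (Or.inl hd)⟩)
    · exact Finset.mem_image_of_mem _ (Finset.mem_filter.2 ⟨hs, le_rfl⟩)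
  have := (Finset.card_le_card h).trans Finset.card_image_le
  rw [Finset.card_range, ← spot_eq] at this
  exact this

theorem spot_le_card (v s : ℕ) : G.spot v s ≤ (G.comp v).card :=
  (place_le_card _ _).trans_eq (card_finalList v)

theorem lt_card_spot {v i : ℕ} (hi : i < (G.comp v).card) :
    i < {s ∈ G.comp v | G.spot v s ≤ i + 1}.card := by
  have h : Finset.Icc 1 (i + 1) ⊆ {s ∈ G.comp v | G.spot v s ≤ i + 1}.image (G.spot v) := by
    intro k hk
    rw [Finset.mem_Icc] at hk
    have hk' : k ∈ (G.finalList v).image (place (G.finalList v)) := by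
      rw [image_place, Finset.mem_Icc, card_finalList]
      omega
    obtain ⟨p, hp, rfl⟩ := Finset.mem_image.1 hk'
    obtain ⟨s, hs, rfl⟩ := Finset.mem_image.1 hp
    exact Finset.mem_image.2 ⟨s, Finset.mem_filter.2 ⟨hs, hk.2⟩, rfl⟩
  have := (Finset.card_le_card h).trans Finset.card_image_le
  rw [Nat.card_Icc] at this
  omega

/-! ## The lists in the course of time -/

variable (G) in
/-- The states of the nodes while the IDs are spread. -/
def census : ℕ → ℕ → Census
  | 0 => fun v => Census.start (G.view v)
  | t + 1 => fun v => (census t v).recv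
      fun u => if G.Linked u v then (census t u).send v else none

theorem census_view (t v : ℕ) : (G.census t v).view = G.view v := by
  induction t with
  | zero => rfl
  | succ t ih => exact ih

theorem census_clock (t v : ℕ) : (G.census t v).clock = t := by
  induction t with
  | zero => rfl
  | succ t ih => exact congrArg (· + 1) ih

theorem mem_nbrs_iff {u v : ℕ} : u ∈ (G.view v).ins ∪ (G.view v).outs ↔ G.Linked u v := by
  rw [Finset.mem_union, mem_ins, mem_outs]

variable (G) in
/-- The pairs known to `v` after round `t + 1`, before the removal of those with a distance that
is not minimal. -/
def collected (t v : ℕ) : Finset (ℕ ×ₗ ℕ) :=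
  (G.census t v).list ∪ ((G.view v).ins ∪ (G.view v).outs).biUnion fun u =>
    Census.offer (if G.Linked u v then (G.census t u).send v else none)

theorem mem_list_succ {t v : ℕ} {p : ℕ ×ₗ ℕ} : p ∈ (G.census (t + 1) v).list ↔
    p ∈ G.collected t v ∧
      ∀ q ∈ G.collected t v, (ofLex q).2 = (ofLex p).2 → (ofLex p).1 ≤ (ofLex q).1 := by
  simp only [census, Census.recv, collected, Finset.mem_filter, census_view]

theorem mem_collected {t v : ℕ} {p : ℕ ×ₗ ℕ} : p ∈ G.collected t v ↔
    p ∈ (G.census t v).list ∨ ∃ u d z, G.Linked u v ∧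
      (G.census t u).send v = some (.ident d z) ∧ p = toLex (d + 1, z) := by
  rw [collected, Finset.mem_union, Finset.mem_biUnion]
  refine or_congr_right ?_
  constructor
  · rintro ⟨u, hu, h⟩
    rw [mem_nbrs_iff] at hu
    rw [if_pos hu, Census.offer.eq_def] at h
    split at h
    · rename_i d z hm
      exact ⟨u, d, z, hu, hm, Finset.mem_singleton.1 h⟩
    · simp at h
  · rintro ⟨u, d, z, hu, hm, rfl⟩
    refine ⟨u, mem_nbrs_iff.2 hu, ?_⟩
    rw [if_pos hu, hm]
    exact Finset.mem_singleton_self _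

theorem exists_of_census_send {t u v : ℕ} {μ : Msg} (h : (G.census t u).send v = some μ) :
    ∃ p ∈ (G.census t u).list, μ = .ident (ofLex p).1 (ofLex p).2 ∧ (ofLex p).1 ≤ t := by
  rw [Census.send] at h
  split_ifs at h
  split at h
  · simp at h
  · rename_i p hp
    obtain ⟨h1, h2⟩ := Finset.mem_filter.1 (mem_of_pick hp)
    have h3 : 0 < place (G.census t u).list p := place_pos h1
    replace h2 : (ofLex p).1 + place (G.census t u).list p = (G.census t u).clock + 1 := h2
    rw [census_clock] at h2
    exact ⟨p, h1, (Option.some.inj h).symm, by omega⟩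

/-- A listed distance is the length of a walk along which the ID has travelled, so it never
underestimates. -/
theorem hop_le_of_mem_list {t v : ℕ} (hv : v ∈ G.verts) {p : ℕ ×ₗ ℕ}
    (hp : p ∈ (G.census t v).list) :
    (ofLex p).2 ∈ G.comp v ∧ G.hop v (ofLex p).2 ≤ (ofLex p).1 := by
  induction t generalizing v p with
  | zero =>
    rw [Finset.mem_singleton.1 hp]
    exact ⟨isIdSets_comp.self_mem v hv, (hop_self v).le⟩
  | succ t ih =>
    rcases mem_collected.1 (mem_list_succ.1 hp).1 with h | ⟨u, d, z, hu, hs, rfl⟩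
    · exact ih hv h
    · obtain ⟨p, hp', hμ, -⟩ := exists_of_census_send hs
      obtain ⟨rfl, rfl⟩ := Msg.ident.inj hμ
      obtain ⟨h1, h2⟩ := ih (Linked.mem_left hu) hp'
      exact ⟨hu.comp_eq ▸ h1, (hop_le hu h1).trans (Nat.succ_le_succ h2)⟩

theorem eq_of_mem_list {t v : ℕ} {p q : ℕ ×ₗ ℕ} (hp : p ∈ (G.census t v).list)
    (hq : q ∈ (G.census t v).list) (h : (ofLex p).2 = (ofLex q).2) : p = q := by
  cases t with
  | zero => rw [Finset.mem_singleton.1 hp, Finset.mem_singleton.1 hq]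
  | succ t =>
    rw [mem_list_succ] at hp hq
    have h1 := hp.2 q hq.1 h.symm
    have h2 := hq.2 p hp.1 h
    exact ofLex.injective (Prod.ext (le_antisymm h1 h2) h)

/-- Without underestimates the true pair survives every clean-up. -/
theorem key_mem_list_succ {t v s : ℕ} (hv : v ∈ G.verts) (h : G.key v s ∈ G.collected t v) :
    G.key v s ∈ (G.census (t + 1) v).list := by
  refine mem_list_succ.2 ⟨h, fun q hq hqs => ?_⟩
  replace hqs : (ofLex q).2 = s := hqs
  change G.hop v s ≤ _
  rw [← hqs]
  rcases mem_collected.1 hq with h | ⟨u, d, z, hu, hs, rfl⟩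
  · exact (hop_le_of_mem_list hv h).2
  · obtain ⟨p, hp, hμ, -⟩ := exists_of_census_send hs
    obtain ⟨rfl, rfl⟩ := Msg.ident.inj hμ
    obtain ⟨h1, h2⟩ := hop_le_of_mem_list (Linked.mem_left hu) hp
    exact (hop_le hu h1).trans (Nat.succ_le_succ h2)

theorem key_mem_list_mono {t v s : ℕ} (hv : v ∈ G.verts)
    (h : G.key v s ∈ (G.census t v).list) : G.key v s ∈ (G.census (t + 1) v).list :=
  key_mem_list_succ hv (mem_collected.2 (Or.inl h))

theorem key_self_mem_list (t : ℕ) {v : ℕ} (hv : v ∈ G.verts) :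
    G.key v v ∈ (G.census t v).list := by
  induction t with
  | zero =>
    rw [key, hop_self]
    exact Finset.mem_singleton_self _
  | succ t ih => exact key_mem_list_mono hv ih

/-- If all pairs whose time has come are on the list, then the next pair is sent. -/
theorem census_send_eq {t u v s : ℕ} (huv : G.Linked u v)
    (hall : ∀ z ∈ G.comp u, G.hop u z + G.spot u z ≤ t + 1 →
      G.key u z ∈ (G.census t u).list)
    (hs : s ∈ G.comp u) (ht : G.hop u s + G.spot u s = t + 1) :
    (G.census t u).send v = some (.ident (G.hop u s) s) := by
  have hu := Linked.mem_left huv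
  have hsl := hall s hs ht.le
  -- Up to the pair of `s` the current list is already final: for a listed `q` there, the true pair
  -- of its ID is no later, hence listed by `hall`, hence equal to `q`.
  have hplace : place (G.census t u).list (G.key u s) = G.spot u s := by
    rw [spot, place, place]
    congr 1
    ext q
    rw [Finset.mem_filter, Finset.mem_filter]
    refine and_congr_left fun hq => ⟨fun h => ?_, fun h => ?_⟩
    · obtain ⟨h1, h2⟩ := hop_le_of_mem_list hu h
      have h3 : G.key u (ofLex q).2 ≤ q := by
        have : q = toLex ((ofLex q).1, (ofLex q).2) := rfl
        rw [this, key, Prod.Lex.toLex_le_toLex]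
        rcases h2.lt_or_eq with h2 | h2
        · exact Or.inl h2
        · exact Or.inr ⟨h2, le_rfl⟩
      have h4 := h3.trans hq
      have h5 : G.spot u (ofLex q).2 ≤ G.spot u s := place_mono _ h4
      have h6 : G.hop u (ofLex q).2 ≤ G.hop u s := by
        rw [key_le_iff] at h4
        omega
      rw [eq_of_mem_list h (hall _ h1 (by omega)) rfl]
      exact key_mem_finalList h1
    · obtain ⟨z, hz, rfl⟩ := Finset.mem_image.1 h
      have h5 : G.spot u z ≤ G.spot u s := place_mono _ hq
      have h6 : G.hop u z ≤ G.hop u s := by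
        rw [key_le_iff] at hq
        omega
      exact hall z hz (by omega)
  have hpick : pick {p ∈ (G.census t u).list | (ofLex p).1 + (G.census t u).index p =
      (G.census t u).clock + 1} = some (G.key u s) := by
    have hsum : (ofLex (G.key u s)).1 + place (G.census t u).list (G.key u s) = t + 1 := by
      rw [hplace]
      exact ht
    refine pick_eq_some (Finset.mem_filter.2 ⟨hsl, ?_⟩) fun q hq => ?_
    · rw [census_clock]
      exact hsum
    · obtain ⟨hq, hqt⟩ := Finset.mem_filter.1 hq
      rw [census_clock] at hqt
      replace hqt : (ofLex q).1 + place (G.census t u).list q = t + 1 := hqt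
      -- Distance plus position strictly increases along a list, so no other pair is due.
      rcases lt_trichotomy q (G.key u s) with h | h | h
      · have h1 := place_lt hsl h
        have h2 : (ofLex q).1 ≤ (ofLex (G.key u s)).1 := by
          rcases Prod.Lex.lt_iff.1 h with h | h
          · exact h.le
          · exact h.1.le
        omega
      · exact h
      · have h1 := place_lt hq h
        have h2 : (ofLex (G.key u s)).1 ≤ (ofLex q).1 := by
          rcases Prod.Lex.lt_iff.1 h with h | h
          · exact h.le
          · exact h.1.le
        omega
  rw [Census.send, if_pos, hpick]
  · rfl
  · rw [census_view, mem_nbrs_iff]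
    exact Or.symm huv

theorem key_mem_list_of_linked {t u v s : ℕ}
    (hall : ∀ t' < t, ∀ z ∈ G.comp u, G.hop u z + G.spot u z ≤ t' + 1 →
      G.key u z ∈ (G.census t' u).list)
    (huv : G.Linked u v) (hs : s ∈ G.comp u) (hd : G.hop v s = G.hop u s + 1)
    (ht : G.hop u s + G.spot u s ≤ t) : G.key v s ∈ (G.census t v).list := by
  have hv := Linked.mem_right huv
  induction t with
  | zero =>
    have : 0 < G.spot u s := place_pos (key_mem_finalList hs)
    omega
  | succ t ih =>
    rcases ht.lt_or_eq with h | h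
    · exact key_mem_list_mono hv
        (ih (fun t' ht' => hall t' (ht'.trans (Nat.lt_succ_self t))) (Nat.lt_succ_iff.1 h))
    · refine key_mem_list_succ hv (mem_collected.2 (Or.inr ?_))
      refine ⟨u, _, _, huv, census_send_eq huv (hall t (Nat.lt_succ_self t)) hs h, ?_⟩
      rw [key, hd]

/-- The pipelining invariant. A neighbor one step closer to `s` has distance plus position at most
`t`, so it has sent the pair within the first `t` rounds. -/
theorem key_mem_list (t : ℕ) {v s : ℕ} (hv : v ∈ G.verts) (hs : s ∈ G.comp v)
    (ht : G.hop v s + G.spot v s ≤ t + 1) : G.key v s ∈ (G.census t v).list := by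
  induction t using Nat.strong_induction_on generalizing v s with
  | _ t ih =>
    rcases hd : G.hop v s with _ | d
    · rw [eq_of_hop_eq_zero hs hd]
      exact key_self_mem_list t hv
    · obtain ⟨u, huv, hsu, hu⟩ := exists_linked_hop hs hd
      have h1 : G.hop v s = G.hop u s + 1 := by omega
      have h2 := spot_le_spot huv h1
      exact key_mem_list_of_linked
        (fun t' ht' z hz hzt => ih t' ht' (Linked.mem_left huv) hz hzt) huv hsu h1 (by omega)

/-- Distance < position ≤ component size, so every pair is in time; uniqueness per ID excludes
anything else. -/
theorem census_list_eq {t v : ℕ} (hv : v ∈ G.verts) (ht : 2 * (G.comp v).card ≤ t) :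
    (G.census t v).list = G.finalList v := by
  have hall : ∀ s ∈ G.comp v, G.key v s ∈ (G.census t v).list := by
    intro s hs
    have := hop_lt_spot hv hs
    have := G.spot_le_card v s
    exact key_mem_list t hv hs (by omega)
  ext p
  constructor
  · intro hp
    have h1 := (hop_le_of_mem_list hv hp).1
    rw [eq_of_mem_list hp (hall _ h1) rfl]
    exact key_mem_finalList h1
  · intro hp
    obtain ⟨s, hs, rfl⟩ := Finset.mem_image.1 hp
    exact hall s hs

theorem census_ids_eq {t v : ℕ} (hv : v ∈ G.verts) (ht : 2 * (G.comp v).card ≤ t) :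
    (G.census t v).ids = G.comp v := by
  rw [Census.ids, census_list_eq hv ht, finalList, Finset.image_image]
  exact Finset.image_id

theorem census_complete {v : ℕ} (hv : v ∈ G.verts) :
    (G.census (2 * (G.comp v).card) v).Complete := by
  rw [Census.Complete, census_clock, census_list_eq hv le_rfl, card_finalList]
  refine ⟨rfl, fun p hp => ?_⟩
  obtain ⟨s, hs, rfl⟩ := Finset.mem_image.1 hp
  exact (hop_lt_spot hv hs).trans_le (G.spot_le_card v s)

/-- Suppose there are `j` pairs after 2`j` rounds, with `j` below the component size. The first `j +
1` pairs of the final list have position at most `j + 1` and distance at most `j`, so `key_mem_list`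
puts all of them on the list. -/
theorem not_census_complete {t v : ℕ} (hv : v ∈ G.verts) (ht : t < 2 * (G.comp v).card) :
    ¬ (G.census t v).Complete := by
  rintro ⟨h, -⟩
  rw [census_clock] at h
  have h1 := lt_card_spot (G := G) (v := v) (i := (G.census t v).list.card) (by omega)
  have h2 : {s ∈ G.comp v | G.spot v s ≤ (G.census t v).list.card + 1}.image (G.key v) ⊆
      (G.census t v).list := by
    intro p hp
    obtain ⟨s, hs, rfl⟩ := Finset.mem_image.1 hp
    obtain ⟨hs, hs'⟩ := Finset.mem_filter.1 hs
    have := hop_lt_spot hv hs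
    exact key_mem_list t hv hs (by omega)
  have h3 := Finset.card_le_card h2
  rw [Finset.card_image_of_injective _ (key_injective v)] at h3
  omega

/-! ## The algorithms for unknown `n` -/

section Unknown

variable {Input Out : Type} {A : DistAlg Input Msg Out}
  {start : LocalView → Finset ℕ → A.State} {F : ℕ → ℕ → A.State}

variable (G) in
/-- The states in a run of an algorithm preceded by the spreading of the IDs. -/
noncomputable def delayed {S : Type} (F : ℕ → ℕ → S) (t v : ℕ) : Census ⊕ S :=
  if t < 2 * (G.comp v).card then .inl (G.census t v) else .inr (F (t - 2 * (G.comp v).card) v)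

theorem isRun_withCensus (hF : A.IsRun G (fun v => start (G.view v) (G.comp v)) F) :
    (withCensus A start).IsRun G (fun v => Sum.inl (Census.start (G.view v))) (G.delayed F) where
  zero := fun v hv => by
    have := isIdSets_comp.card_pos hv
    exact if_pos (by omega)
  succ := fun t v hv => by
    -- Neighbors share a component and hence the switching round, so the two phases never exchange
    -- messages.
    have hc : ∀ u, G.Linked u v → (G.comp u).card = (G.comp v).card := fun u hu => by
      rw [hu.comp_eq]
    by_cases h : t < 2 * (G.comp v).card
    · have hin : (fun u => if G.Linked u v then
          (withCensus A start).send (G.delayed F t u) v else none) =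
          fun u => if G.Linked u v then (G.census t u).send v else none := by
        funext u
        split_ifs with hu
        · rw [delayed, if_pos (by rw [hc u hu]; exact h)]
          rfl
        · rfl
      rw [hin, delayed, delayed, if_pos h]
      change _ = if (G.census (t + 1) v).Complete then
        Sum.inr (start (G.census (t + 1) v).view (G.census (t + 1) v).ids)
        else Sum.inl (G.census (t + 1) v)
      by_cases h' : t + 1 < 2 * (G.comp v).card
      · rw [if_pos h', if_neg (not_census_complete hv h')]
      · have h2 : t + 1 = 2 * (G.comp v).card := by omega
        rw [if_neg h', h2, if_pos (census_complete hv), Nat.sub_self, hF.zero v hv,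
          census_view, census_ids_eq hv le_rfl]
    · have hin : (fun u => if G.Linked u v then
          (withCensus A start).send (G.delayed F t u) v else none) =
          fun u => if G.Linked u v then
            A.send (F (t - 2 * (G.comp v).card) u) v else none := by
        funext u
        split_ifs with hu
        · rw [delayed, hc u hu, if_neg h]
          rfl
        · rfl
      rw [hin, delayed, delayed, if_neg h, if_neg (by omega),
        Nat.sub_add_comm (not_lt.1 h), hF.succ _ v hv]
      rfl

theorem output_delayed {t v : ℕ} {o : Out}
    (h : (withCensus A start).output (G.delayed F t v) = some o) :
    2 * (G.comp v).card ≤ t ∧ A.output (F (t - 2 * (G.comp v).card) v) = some o := by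
  rw [delayed] at h
  split_ifs at h with ht
  · exact absurd h (by simp [withCensus])
  · exact ⟨not_lt.1 ht, h⟩

theorem quiet_withCensus (hQ : A.Quiet G F) : (withCensus A start).Quiet G (G.delayed F) := by
  intro t v h t' ht w hw
  obtain ⟨o, ho⟩ := Option.isSome_iff_exists.1 h
  obtain ⟨h1, h2⟩ := output_delayed ho
  rw [delayed, if_neg (by omega)]
  exact hQ _ v (by rw [h2]; rfl) _ (Nat.sub_le_sub_right ht _) w hw

theorem census_bits_le {s t u v : ℕ} {μ : Msg} (hs : ∀ x ∈ G.verts, x.size ≤ s)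
    (hu : u ∈ G.verts) (ht : t < 2 * (G.comp u).card)
    (h : (G.census t u).send v = some μ) : μ.bits ≤ 4 + s + G.n.size := by
  obtain ⟨p, hp, rfl, hpt⟩ := exists_of_census_send h
  have h1 := hs _ (isIdSets_comp.subset u hu (hop_le_of_mem_list hu hp).1)
  have h2 := isIdSets_comp.card_le hu
  -- A distance sent before the switch is at most `t`, which is less than 2n: one extra bit.
  have h3 : (ofLex p).1.size ≤ G.n.size + 1 := by
    rw [Nat.size_le, pow_succ]
    have := Nat.lt_size_self G.n
    omega
  simp only [Msg.bits]
  omega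

theorem size_le_of_subset {k x : ℕ} (h : G.verts ⊆ Finset.Icc 1 (G.n ^ k)) (hx : x ∈ G.verts) :
    x.size ≤ k * G.n.size + 1 := by
  have h1 := (Finset.mem_Icc.1 (h hx)).2
  rw [Nat.size_le]
  calc x ≤ G.n ^ k := h1
    _ ≤ (2 ^ G.n.size) ^ k := Nat.pow_le_pow_left (Nat.lt_size_self _).le k
    _ = 2 ^ (k * G.n.size) := by rw [← pow_mul, mul_comm]
    _ < 2 ^ (k * G.n.size + 1) := Nat.pow_lt_pow_right one_lt_two (Nat.lt_succ_self _)

theorem computes_withCensus {spec : ℕ → Out → Prop} {k c B : ℕ}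
    (hk : G.verts ⊆ Finset.Icc 1 (G.n ^ k))
    (hF : A.IsRun G (fun v => start (G.view v) (G.comp v)) F) (hQ : A.Quiet G F)
    (hout : ∀ v ∈ G.verts, ∀ t ≥ c * G.n, (A.output (F t v)).isSome)
    (hspec : ∀ v ∈ G.verts, ∀ t o, A.output (F t v) = some o → spec v o)
    (hB : G.n.size ≤ B)
    (hlen : ∀ s, (∀ x ∈ G.verts, x.size ≤ s) → ∀ t u v μ, G.Linked u v →
      A.send (F t u) v = some μ → μ.bits ≤ 3 + s + B) :
    (withCensus A start).Computes Msg.bits G G.view spec ((c + 2) * G.n)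
      (2 * (c + 2) * (G.m * G.n)) (6 * (k + 1) * B) := by
  have hR := isRun_withCensus hF
  have hQ' := quiet_withCensus (start := start) hQ
  refine DistAlg.computes_of_isRun hR hQ' le_rfl (fun v hv => ?_) (fun v hv t o ho => ?_) ?_
    (fun t u v μ huv hμ => ?_)
  · have h1 := isIdSets_comp.card_le hv
    have h2 : (c + 2) * G.n = c * G.n + 2 * G.n := add_mul _ _ _
    rw [delayed, if_neg (by omega)]
    exact hout v hv _ (by omega)
  · exact hspec v hv _ o (output_delayed ho).2
  -- One message per round and direction is a sufficient bound here.
  · refine (DistAlg.messages_le hR hQ' (a := (c + 2) * G.n) (b := (c + 2) * G.n)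
      (fun u v _ => ?_) fun u v _ => ?_).trans_eq (by ring)
    · exact (Finset.card_filter_le _ _).trans_eq (Finset.card_range _)
    · exact (Finset.card_filter_le _ _).trans_eq (Finset.card_range _)
  · have hu := Linked.mem_left huv
    have hs := fun x hx => size_le_of_subset (x := x) hk hx
    have hpos := (n_size_pos hu).trans_le hB
    have h1 : k * G.n.size ≤ k * B := Nat.mul_le_mul_left k hB
    have h2 : 6 * (k + 1) * B = 6 * (k * B) + 6 * B := by ring
    rw [delayed] at hμ
    split_ifs at hμ with ht
    · have := census_bits_le hs hu ht hμ
      omega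
    · have := hlen _ hs _ u v μ huv hμ
      omega

end Unknown

theorem longest_le_n : G.longest ≤ G.n := by
  rcases G.verts.eq_empty_or_nonempty with h | h
  · refine (Nat.le_of_eq ?_).trans (Nat.zero_le _)
    have : {k | ∃ x y p, G.IsPath x y p ∧ p.length = k + 1} = ∅ := by
      ext k
      simp only [Set.mem_ofPred_eq, Set.mem_empty_iff_false, iff_false]
      rintro ⟨x, y, p, hp, -⟩
      simpa [h] using hp.1 y hp.mem_right
    rw [longest, this, csSup_empty, bot_eq_zero]
  · exact (longest_lt_n h).le

theorem computes_dagAPSPUnknown {k : ℕ} (hk : G.verts ⊆ Finset.Icc 1 (G.n ^ k)) :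
    dagAPSPUnknown.Computes Msg.bits G G.view G.APSPSpec (5 * G.n) (2 * 5 * (G.m * G.n))
      (6 * (k + 1) * G.apspB) := by
  have hI := G.isIdSets_comp
  -- `c = 3` covers card + level + 1 ≤ 3n.
  refine computes_withCensus (c := 3) hk (isRun_dagAPSP hI) quiet_dagAPSP (fun v hv t ht => ?_)
    (fun v hv t o ho => ?_) n_size_le_apspB fun s hs t u v μ _ hμ => coreAt_bits_le hI hs hμ
  · refine (coreAt_output_isSome t v).2 ?_
    have := hI.card_le hv
    have := hI.card_pos hv
    have := lev_le_longest hv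
    have := G.longest_le_n
    split_ifs <;> omega
  · obtain ⟨ht, rfl⟩ := coreAt_output_eq ho
    exact apspSpec_coreAt hI hv ht

theorem computes_dagBCUnknown {k : ℕ} (hk : G.verts ⊆ Finset.Icc 1 (G.n ^ k)) :
    dagBCUnknown.Computes Msg.bits G G.view G.BCSpec (6 * G.n) (2 * 6 * (G.m * G.n))
      (6 * (k + 1) * G.bcB) := by
  have hI := G.isIdSets_comp
  -- `c = 4` covers the sum 2(card + `topLev`) ≤ 4n.
  refine computes_withCensus (c := 4) hk (isRun_dagBC hI) (quiet_dagBC hI) (fun v hv t ht => ?_)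
    (fun v hv t o ho => bcSpec_bcAt hI hv ho) (n_size_le_apspB.trans apspB_le_bcB)
    fun s hs t u v μ huv hμ => bcAt_bits_le hI hs huv hμ
  refine bcAt_output_isSome.2 ?_
  have := hI.card_le hv
  have := topLev_le_longest hv
  have := G.longest_le_n
  omega

end WDag

theorem DistAlg.Computes.mono {Input Msg Out : Type} {A : DistAlg Input Msg Out} {bits : Msg → ℕ}
    {G : WDag} {inp : ℕ → Input} {spec : ℕ → Out → Prop} {r r' m m' l l' : ℕ}
    (h : A.Computes bits G inp spec r m l) (hr : r ≤ r') (hm : m ≤ m') (hl : l ≤ l') :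
    A.Computes bits G inp spec r' m' l' := by
  obtain ⟨T, hT, h1, h2, h3⟩ := h
  exact ⟨T, hT.trans hr, h1, h2.trans hm, fun t u hu v hv μ hμ => (h3 t u hu v hv μ hμ).trans hl⟩

theorem theorem2 :
    -- `n` known, APSP
    (∃ C : ℕ, ∀ G : WDag, G.verts = Finset.Icc 1 G.n →
      dagAPSP.Computes Msg.bits G (fun v => (G.n, G.view v)) G.APSPSpec
        (G.n + C * G.longest) (G.m * G.n + G.m) (C * G.apspB)) ∧
    -- `n` known, BC
    (∃ C : ℕ, ∀ G : WDag, G.verts = Finset.Icc 1 G.n →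
      dagBC.Computes Msg.bits G (fun v => (G.n, G.view v)) G.BCSpec
        (2 * G.n + C * G.longest) (2 * (G.m * G.n) + G.m) (C * G.bcB)) ∧
    -- `n` unknown, APSP
    (∃ C : ℕ, ∀ k : ℕ, ∀ G : WDag, G.verts ⊆ Finset.Icc 1 (G.n ^ k) →
      dagAPSPUnknown.Computes Msg.bits G G.view G.APSPSpec
        (C * G.n) (C * (G.m * G.n)) (C * (k + 1) * G.apspB)) ∧
    -- `n` unknown, BC
    (∃ C : ℕ, ∀ k : ℕ, ∀ G : WDag, G.verts ⊆ Finset.Icc 1 (G.n ^ k) →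
      dagBCUnknown.Computes Msg.bits G G.view G.BCSpec
        (C * G.n) (C * (G.m * G.n)) (C * (k + 1) * G.bcB)) := by
  -- 5 is forced by the message lengths; 12 = 2 · 6 comes from the message count of BC and is more
  -- than APSP needs.
  refine ⟨⟨5, fun G h => ?_⟩, ⟨5, fun G h => ?_⟩, ⟨12, fun k G h => ?_⟩,
    ⟨12, fun k G h => ?_⟩⟩
  · exact (WDag.computes_dagAPSP h).mono (by omega) (by omega) le_rfl
  · exact (WDag.computes_dagBC h).mono (by omega) (by rw [mul_add]; omega) le_rfl
  · refine (WDag.computes_dagAPSPUnknown h).mono (by omega) (by omega) ?_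
    gcongr
    norm_num
  · refine (WDag.computes_dagBCUnknown h).mono (by omega) (by omega) ?_
    gcongr
    norm_num
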